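/- A bimatrix game with payoff matrices $P, Q \in \mathbb{R}^{r\times s}$ ($r,s\ge 1$) is played by a row player, who receives $P$, and a column player, who receives $Q$. A (mixed) Nash equilibrium is a pair of probability vectors $(x^*,y^*)\in\Delta_{r-1}\times\Delta_{s-1}$ such that ${x^*}^{\top} P y^* \ge x^{\top} P y^*$ and ${x^*}^{\top} Q y^* \ge {x^*}^{\top} Q y$ for all $(x,y)\in\Delta_{r-1}\times\Delta_{s-1}$, where $\Delta_{n-1}$ is the set of nonnegative vectors in $\mathbb{R}^n$ whose entries sum to $1$. Consider the games with entrywise nonnegative $P, Q\in\mathbb{R}_{\ge 0}^{r\times s}$ such that every column of $P$ has an entry that is (strictly) more than $r-1$ times every other entry of that column, and every column of $Q^{\top}$ has an entry that is (strictly) more than $s-1$ times every other entry of that column. For these games a Nash equilibrium can be computed in polynomial time. Precisely, there is a single random access machine program, whose operations on numbers are $+,-,\times,/$ and comparisons and whose only constants are integers, and there are polynomials $p$ and $q$, such that: 1. for every such game with real payoffs, the program run on $(P,Q)$ halts with a Nash equilibrium after time at most $p(r+s)$, where every operation on real numbers has unit cost (and indices and addresses are charged their bit length); 2. for every such game with rational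 payoffs, the program run on $(P,Q)$ halts with a rational Nash equilibrium after time at most $q(L)$, where $L$ is the total bit length of the entries of $P$ and $Q$, and every operation is charged the bit length of its operands, its result and the addresses involved (logarithmic cost). -/

import Mathlib

/-! ### Bimatrix games -/

/-- The mixed strategies over `n` actions (the standard simplex of dimension `n - 1`). -/
def IsMixedStrategy {n : ℕ} (x : Fin n → ℝ) : Prop :=
  (∀ i, 0 ≤ x i) ∧ ∑ i, x i = 1

/-- The expected payoff `xᵀ A y`. -/
def payoff {r s : ℕ} (A : Matrix (Fin r) (Fin s) ℝ) (x : Fin r → ℝ) (y : Fin s → ℝ) : ℝ :=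
  ∑ i, ∑ j, x i * A i j * y j

/-- `(x, y)` is a Nash equilibrium (in mixed strategies) of the bimatrix game in which the row
player receives `P` and the column player receives `Q`. -/
def IsNashEquilibrium {r s : ℕ} (P Q : Matrix (Fin r) (Fin s) ℝ)
    (x : Fin r → ℝ) (y : Fin s → ℝ) : Prop :=
  IsMixedStrategy x ∧ IsMixedStrategy y ∧
    (∀ x' : Fin r → ℝ, IsMixedStrategy x' → payoff P x' y ≤ payoff P x y) ∧
    (∀ y' : Fin s → ℝ, IsMixedStrategy y' → payoff Q x y' ≤ payoff Q x y)

/-- Every column of the matrix `A` (with `m` rows) has an entry that is more than `m - 1` times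
every other entry of that column. -/
def HasDominantColumnEntries {m n : ℕ} (A : Matrix (Fin m) (Fin n) ℝ) : Prop :=
  ∀ j, ∃ i, ∀ k, k ≠ i → ((m : ℝ) - 1) * A k j < A i j

/-! ### A random access machine over an ordered field, with a running time

The machine has natural-number index registers, and arrays of numbers of an ordered field `K`
whose entries are addressed through the index registers.  Programs are finite, do not depend on
the field, and contain no constants besides integers. -/

namespace FieldRAM

/-- A reference to the entry of the array `arr` whose row and column are the current contents of
the index registers `row` and `col`. -/
structure Ref where
  arr : ℕ
  row : ℕ
  col : ℕ

/-- The four arithmetic operations. -/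
inductive ArithOp
  | add
  | sub
  | mul
  | div

/-- Tests: comparisons of two index registers, or of two numbers. -/
inductive Test
  | idxLt (a b : ℕ)
  | idxEq (a b : ℕ)
  | numLt (u v : Ref)
  | numEq (u v : Ref)

/-- Programs. -/
inductive Prog
  /-- do nothing -/
  | skip
  /-- put the constant `n` into index register `a` -/
  | setIdx (a n : ℕ)
  /-- put the sum of the index registers `b` and `c` into index register `a` -/
  | addIdx (a b c : ℕ)
  /-- put the truncated difference of the index registers `b` and `c` into index register `a` -/
  | subIdx (a b c : ℕ)
  /-- write the integer constant `z` at `u` -/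
  | const (u : Ref) (z : ℤ)
  /-- copy the number at `v` to `u` -/
  | copy (u v : Ref)
  /-- apply an operation to the numbers at `v` and `w`, and write the result at `u` -/
  | arith (o : ArithOp) (u v w : Ref)
  /-- run the first program, then the second one -/
  | seq (c d : Prog)
  /-- run the first program if the test succeeds, and the second one otherwise -/
  | cond (b : Test) (c d : Prog)
  /-- run the program as long as the test succeeds -/
  | loop (b : Test) (c : Prog)

/-- The content of the memory: index registers `idx a`, and arrays of numbers `num A i j`. -/
structure Store (K : Type) where
  idx : ℕ → ℕ
  num : ℕ → ℕ → ℕ → K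

section Semantics

variable {K : Type} [Field K] [LinearOrder K]

/-- The number at a reference. -/
def Store.get (σ : Store K) (u : Ref) : K :=
  σ.num u.arr (σ.idx u.row) (σ.idx u.col)

/-- Overwrite an index register. -/
def Store.putIdx (σ : Store K) (a n : ℕ) : Store K where
  idx := fun b => if b = a then n else σ.idx b
  num := σ.num

/-- Overwrite the number at a reference. -/
def Store.put (σ : Store K) (u : Ref) (x : K) : Store K where
  idx := σ.idx
  num := fun A i j =>
    if A = u.arr ∧ i = σ.idx u.row ∧ j = σ.idx u.col then x else σ.num A i j

/-- Only a division by zero is illegal. -/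
def ArithOp.Legal : ArithOp → K → K → Prop
  | .div, _, y => y ≠ 0
  | _, _, _ => True

/-- The result of an arithmetic operation. -/
def ArithOp.val : ArithOp → K → K → K
  | .add, x, y => x + y
  | .sub, x, y => x - y
  | .mul, x, y => x * y
  | .div, x, y => x / y

/-- The truth of a test. -/
def Test.Holds (σ : Store K) : Test → Prop
  | .idxLt a b => σ.idx a < σ.idx b
  | .idxEq a b => σ.idx a = σ.idx b
  | .numLt u v => σ.get u < σ.get v
  | .numEq u v => σ.get u = σ.get v

/-- The number of bits of the address of a reference. -/
def Store.addrCost (σ : Store K) (u : Ref) : ℕ :=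
  Nat.size (σ.idx u.row) + Nat.size (σ.idx u.col)

/-- The cost of a test: one, plus the sizes of all addresses and operands, where `sz` is the size
of a number. -/
def Test.cost (sz : K → ℕ) (σ : Store K) : Test → ℕ
  | .idxLt a b => 1 + Nat.size (σ.idx a) + Nat.size (σ.idx b)
  | .idxEq a b => 1 + Nat.size (σ.idx a) + Nat.size (σ.idx b)
  | .numLt u v => 1 + σ.addrCost u + sz (σ.get u) + σ.addrCost v + sz (σ.get v)
  | .numEq u v => 1 + σ.addrCost u + sz (σ.get u) + σ.addrCost v + sz (σ.get v)

/-- `Exec sz c σ τ t`: the program `c`, started in the store `σ`, halts in the store `τ` after the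
time `t`.  Every instruction and every test costs one, plus the sizes of all addresses, operands
and results involved, where an index `n` has its number of bits `Nat.size n` as its size, and a
number `x` has the size `sz x`. -/
inductive Exec (sz : K → ℕ) : Prog → Store K → Store K → ℕ → Prop
  | skip (σ : Store K) : Exec sz .skip σ σ 1
  | setIdx (a n : ℕ) (σ : Store K) :
      Exec sz (.setIdx a n) σ (σ.putIdx a n) (1 + Nat.size n)
  | addIdx (a b c : ℕ) (σ : Store K) :
      Exec sz (.addIdx a b c) σ (σ.putIdx a (σ.idx b + σ.idx c))
        (1 + Nat.size (σ.idx b) + Nat.size (σ.idx c) + Nat.size (σ.idx b + σ.idx c))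
  | subIdx (a b c : ℕ) (σ : Store K) :
      Exec sz (.subIdx a b c) σ (σ.putIdx a (σ.idx b - σ.idx c))
        (1 + Nat.size (σ.idx b) + Nat.size (σ.idx c) + Nat.size (σ.idx b - σ.idx c))
  | const (u : Ref) (z : ℤ) (σ : Store K) :
      Exec sz (.const u z) σ (σ.put u (z : K)) (1 + σ.addrCost u + sz (z : K))
  | copy (u v : Ref) (σ : Store K) :
      Exec sz (.copy u v) σ (σ.put u (σ.get v))
        (1 + σ.addrCost u + σ.addrCost v + sz (σ.get v))
  | arith (o : ArithOp) (u v w : Ref) (σ : Store K) (h : o.Legal (σ.get v) (σ.get w)) :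
      Exec sz (.arith o u v w) σ (σ.put u (o.val (σ.get v) (σ.get w)))
        (1 + σ.addrCost u + σ.addrCost v + σ.addrCost w + sz (σ.get v) + sz (σ.get w)
          + sz (o.val (σ.get v) (σ.get w)))
  | seq {c d : Prog} {σ τ ρ : Store K} {t t' : ℕ} (h : Exec sz c σ τ t) (h' : Exec sz d τ ρ t') :
      Exec sz (.seq c d) σ ρ (t + t')
  | condTrue {b : Test} {c d : Prog} {σ τ : Store K} {t : ℕ} (hb : b.Holds σ)
      (h : Exec sz c σ τ t) : Exec sz (.cond b c d) σ τ (b.cost sz σ + t)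
  | condFalse {b : Test} {c d : Prog} {σ τ : Store K} {t : ℕ} (hb : ¬ b.Holds σ)
      (h : Exec sz d σ τ t) : Exec sz (.cond b c d) σ τ (b.cost sz σ + t)
  | loopTrue {b : Test} {c : Prog} {σ τ ρ : Store K} {t t' : ℕ} (hb : b.Holds σ)
      (h : Exec sz c σ τ t) (h' : Exec sz (.loop b c) τ ρ t') :
      Exec sz (.loop b c) σ ρ (b.cost sz σ + t + t')
  | loopFalse {b : Test} {c : Prog} {σ : Store K} (hb : ¬ b.Holds σ) :
      Exec sz (.loop b c) σ σ (b.cost sz σ)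

/-- The initial store on input `P`, `Q`: the numbers `r` and `s` of rows and columns are in the
index registers `0` and `1`, the matrices are in the arrays `0` and `1`, and everything else is
zero. -/
def inputStore {r s : ℕ} (P Q : Matrix (Fin r) (Fin s) K) : Store K where
  idx := fun a => if a = 0 then r else if a = 1 then s else 0
  num := fun A i j =>
    if h : i < r ∧ j < s then
      if A = 0 then P ⟨i, h.1⟩ ⟨j, h.2⟩ else if A = 1 then Q ⟨i, h.1⟩ ⟨j, h.2⟩ else 0
    else 0

/-- The vector of length `n` in column `0` of the array `A`. -/
def outputVec (A n : ℕ) (σ : Store K) : Fin n → K :=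
  fun i => σ.num A i 0

end Semantics

/-- The unit-cost measure on real numbers: an operation on real numbers costs one, plus the size
of the addresses. -/
def unitSize : ℝ → ℕ := fun _ => 0

/-- The number of bits of a rational number: sign, numerator and denominator in binary. -/
def bitSize (q : ℚ) : ℕ := 1 + Nat.size q.num.natAbs + Nat.size q.den

/-- The number of bits of a pair of rational matrices. -/
def inputBitSize {r s : ℕ} (P Q : Matrix (Fin r) (Fin s) ℚ) : ℕ :=
  ∑ i, ∑ j, (bitSize (P i j) + bitSize (Q i j))

/-- On the input `P`, `Q` (with entries in `K`, embedded into the reals by `ι`), the program `c`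
halts within the time `T` and outputs a Nash equilibrium: the strategies of the row player and of
the column player are in the arrays `2` and `3`. -/
def FindsNashWithin {K : Type} [Field K] [LinearOrder K] (ι : K → ℝ) (sz : K → ℕ) (c : Prog)
    {r s : ℕ} (P Q : Matrix (Fin r) (Fin s) K) (T : ℕ) : Prop :=
  ∃ (τ : Store K) (t : ℕ), Exec sz c (inputStore P Q) τ t ∧ t ≤ T ∧
    IsNashEquilibrium (P.map ι) (Q.map ι)
      (fun i => ι (outputVec 2 r τ i)) (fun j => ι (outputVec 3 s τ j))

end FieldRAM

/-! Suppose both players have at least two actions. Let `β i` be the best column against row `i` and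
`α j` the best row against column `j`. Following `α ∘ β` from any row leads, after at most `r`
steps, onto a cycle `S`. On it `α ∘ β` is a bijection, so `β` maps `S` bijectively onto a set `T` of
columns and `α` maps `T` bijectively back onto `S`.

Dominance makes `S` and `T` the supports allowed for an equilibrium. Seek `x` supported on `S` that
gives every column of `T` the payoff `1` for the column player. In the scaled unknowns `z i = Q i (β
i) * x i` the system has ones on its diagonal and nonnegative off-diagonal entries less than `1 / (s
- 1)`, at most `s - 1` of them in a row, so it is strictly diagonally dominant. Hence it is
nonsingular, and centring the unknowns at `1 / 2` shows `0 ≤ z ≤ 1` (`indiffMatrix_solution_mem`). A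
column outside `T` earns at most `|S| / (s - 1) ≤ 1`, because then `T` misses a column
(`indiffMatrix_solution_payoff_le`). The same holds for `y` supported on `T`, and normalizing both
vectors gives an equilibrium (`isNashEquilibrium_of_indiffMatrix`).

The systems are solved by rank-one updates of an inverse. The start is the identity matrix, which
belongs to the empty support, and each point of the cycle replaces one row. Every intermediate
matrix belongs to a subset of the support and is nonsingular for the same reason, so no pivot
vanishes and no pivot search is needed. Repeating a row changes nothing, so `r` rounds suffice
without finding the length of the cycle.

For the bit cost, the numbers stored between updates are entries of inverses of matrices built from
the input, and of their solutions. Cramer's rule bounds their size afresh at each round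
(`FracBound.matrix_inv`), so growth does not accumulate; within an update only a polynomial increase
occurs. One correctness proof, parametrized by a `SizeScale`, serves both the real and the rational
cost measure. If a player has a single action, a pure equilibrium is found directly. -/

set_option linter.unusedSectionVars false

/-! ### Program logic with resource bounds -/

namespace FieldRAM

/-- Resources of a run: a size measure, a class of admissible numbers whose size is at most `bits`,
and a bound `maxIdx` for the contents of the index registers. -/
structure Budget (K : Type) where
  sz : K → ℕ
  small : K → Prop
  bits : ℕ
  maxIdx : ℕ
  sz_le : ∀ x, small x → sz x ≤ bits

section Logic

variable {K : Type} [Field K] [LinearOrder K]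

@[simp] theorem Store.putIdx_idx (σ : Store K) (a n b : ℕ) :
    (σ.putIdx a n).idx b = if b = a then n else σ.idx b := rfl

@[simp] theorem Store.putIdx_num (σ : Store K) (a n : ℕ) : (σ.putIdx a n).num = σ.num := rfl

@[simp] theorem Store.put_idx (σ : Store K) (u : Ref) (x : K) : (σ.put u x).idx = σ.idx := rfl

theorem Store.put_num (σ : Store K) (u : Ref) (x : K) (A i j : ℕ) :
    (σ.put u x).num A i j =
      if A = u.arr ∧ i = σ.idx u.row ∧ j = σ.idx u.col then x else σ.num A i j := rfl

theorem Store.put_num_of_ne (σ : Store K) (u : Ref) (x : K) {A : ℕ} (h : A ≠ u.arr) :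
    (σ.put u x).num A = σ.num A := by
  funext i j
  simp [Store.put_num, h]

/-- All registers and all numbers of the store are within the budget. -/
def Budget.Holds (E : Budget K) (σ : Store K) : Prop :=
  (∀ a, σ.idx a ≤ E.maxIdx) ∧ ∀ A i j, E.small (σ.num A i j)

/-- A bound for the cost of an instruction. -/
def Budget.unit (E : Budget K) : ℕ := 1 + 6 * E.maxIdx + 3 * E.bits

/-- Started in a store within the budget, the program halts after at most `k` instructions and
tests in a store within the budget that satisfies `Post`. -/
def Budget.Runs (E : Budget K) (c : Prog) (k : ℕ) (Post : Store K → Prop) (σ : Store K) : Prop :=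
  E.Holds σ → ∃ τ t, Exec E.sz c σ τ t ∧ t ≤ k * E.unit ∧ E.Holds τ ∧ Post τ

/-- A crude bound is enough for addresses, since indices never exceed a bound that is itself allowed
to enter the time polynomially. -/
theorem size_le_self (n : ℕ) : Nat.size n ≤ n := Nat.size_le.2 Nat.lt_two_pow_self

variable {E : Budget K} {σ : Store K} {Post Post' : Store K → Prop} {c d : Prog} {k k' : ℕ}

theorem Budget.Holds.size_idx (h : E.Holds σ) (a : ℕ) : Nat.size (σ.idx a) ≤ E.maxIdx :=
  (size_le_self _).trans (h.1 a)

theorem Budget.Holds.addrCost (h : E.Holds σ) (u : Ref) : σ.addrCost u ≤ 2 * E.maxIdx := by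
  have h1 := h.size_idx u.row
  have h2 := h.size_idx u.col
  unfold Store.addrCost
  omega

theorem Budget.Holds.sz_get (h : E.Holds σ) (u : Ref) : E.sz (σ.get u) ≤ E.bits :=
  E.sz_le _ (h.2 _ _ _)

theorem Budget.Holds.test_cost (h : E.Holds σ) (b : Test) : b.cost E.sz σ ≤ E.unit := by
  unfold Budget.unit
  cases b with
  | idxLt a b => have := h.size_idx a; have := h.size_idx b; simp only [Test.cost]; omega
  | idxEq a b => have := h.size_idx a; have := h.size_idx b; simp only [Test.cost]; omega
  | numLt u v =>
    have := h.addrCost u; have := h.addrCost v; have := h.sz_get u; have := h.sz_get v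
    simp only [Test.cost]; omega
  | numEq u v =>
    have := h.addrCost u; have := h.addrCost v; have := h.sz_get u; have := h.sz_get v
    simp only [Test.cost]; omega

theorem Budget.Holds.putIdx (h : E.Holds σ) {a n : ℕ} (hn : n ≤ E.maxIdx) :
    E.Holds (σ.putIdx a n) := by
  refine ⟨fun b => ?_, h.2⟩
  rw [Store.putIdx_idx]
  split
  · exact hn
  · exact h.1 b

theorem Budget.Holds.put (h : E.Holds σ) {u : Ref} {x : K} (hx : E.small x) :
    E.Holds (σ.put u x) := by
  refine ⟨h.1, fun A i j => ?_⟩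
  rw [Store.put_num]
  split
  · exact hx
  · exact h.2 A i j

theorem Budget.Runs.mono (h : E.Runs c k Post σ) (hk : k ≤ k') (hP : ∀ τ, Post τ → Post' τ) :
    E.Runs c k' Post' σ := by
  intro hσ
  obtain ⟨τ, t, h1, h2, h3, h4⟩ := h hσ
  exact ⟨τ, t, h1, h2.trans (Nat.mul_le_mul_right _ hk), h3, hP _ h4⟩

/-- The postcondition of the first program is that the second one runs correctly. A program is thus
verified forwards, along its text, without naming intermediate assertions. -/
theorem Budget.Runs.seq (h : E.Runs c k (E.Runs d k' Post) σ) :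
    E.Runs (.seq c d) (k + k') Post σ := by
  intro hσ
  obtain ⟨τ, t, h1, h2, h3, h4⟩ := h hσ
  obtain ⟨ρ, t', g1, g2, g3, g4⟩ := h4 h3
  exact ⟨ρ, t + t', .seq h1 g1, by rw [Nat.add_mul]; omega, g3, g4⟩

theorem Budget.Runs.skip (h : Post σ) : E.Runs .skip 1 Post σ := by
  intro hσ
  exact ⟨σ, 1, .skip σ, by unfold Budget.unit; omega, hσ, h⟩

theorem Budget.Runs.setIdx {a n : ℕ} (hn : n ≤ E.maxIdx) (h : Post (σ.putIdx a n)) :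
    E.Runs (.setIdx a n) 1 Post σ := by
  intro hσ
  refine ⟨_, _, .setIdx a n σ, ?_, hσ.putIdx hn, h⟩
  have := size_le_self n
  unfold Budget.unit
  omega

theorem Budget.Runs.addIdx {a b c : ℕ} (hn : σ.idx b + σ.idx c ≤ E.maxIdx)
    (h : Post (σ.putIdx a (σ.idx b + σ.idx c))) : E.Runs (.addIdx a b c) 1 Post σ := by
  intro hσ
  refine ⟨_, _, .addIdx a b c σ, ?_, hσ.putIdx hn, h⟩
  have := size_le_self (σ.idx b + σ.idx c)
  have := hσ.size_idx b
  have := hσ.size_idx c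
  unfold Budget.unit
  omega

theorem Budget.Runs.const {u : Ref} {z : ℤ} (hz : E.small (z : K)) (h : Post (σ.put u (z : K))) :
    E.Runs (.const u z) 1 Post σ := by
  intro hσ
  refine ⟨_, _, .const u z σ, ?_, hσ.put hz, h⟩
  have := hσ.addrCost u
  have := E.sz_le _ hz
  unfold Budget.unit
  omega

theorem Budget.Runs.arith {o : ArithOp} {u v w : Ref} (hl : o.Legal (σ.get v) (σ.get w))
    (hx : E.small (o.val (σ.get v) (σ.get w))) (h : Post (σ.put u (o.val (σ.get v) (σ.get w)))) :
    E.Runs (.arith o u v w) 1 Post σ := by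
  intro hσ
  refine ⟨_, _, .arith o u v w σ hl, ?_, hσ.put hx, h⟩
  have := hσ.addrCost u
  have := hσ.addrCost v
  have := hσ.addrCost w
  have := hσ.sz_get v
  have := hσ.sz_get w
  have := E.sz_le _ hx
  unfold Budget.unit
  omega

theorem Budget.Runs.cond {b : Test} (h₁ : b.Holds σ → E.Runs c k Post σ)
    (h₂ : ¬ b.Holds σ → E.Runs d k Post σ) : E.Runs (.cond b c d) (k + 1) Post σ := by
  intro hσ
  have hc := hσ.test_cost b
  by_cases hb : b.Holds σ
  · obtain ⟨τ, t, g1, g2, g3, g4⟩ := h₁ hb hσ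
    exact ⟨τ, _, .condTrue hb g1, by rw [Nat.add_mul]; omega, g3, g4⟩
  · obtain ⟨τ, t, g1, g2, g3, g4⟩ := h₂ hb hσ
    exact ⟨τ, _, .condFalse hb g1, by rw [Nat.add_mul]; omega, g3, g4⟩

/-- Run `c` for the values `0, 1, …, n - 1` of the register `a`, where `n` is the content of the
register `b`. The register `3` has to contain `1`. -/
def Prog.for (a b : ℕ) (c : Prog) : Prog :=
  .seq (.setIdx a 0) (.loop (.idxLt a b) (.seq c (.addIdx a a 3)))

/-- The number of steps of a loop with at most `n` rounds of `T` steps each. -/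
def loopSteps (n T : ℕ) : ℕ := n * (T + 2) + 2

/-- Invariant rule. The body must preserve the counter and the constant `1` in register `3`, so that
the increment leads to `I (l + 1)`. A round costs `T` steps, one test and one increment;
initialization and the last test account for the other two steps. The step count uses `E.maxIdx`
instead of `m` so that it depends on the budget alone. -/
theorem Budget.Runs.for {a b m T : ℕ} (I : ℕ → Store K → Prop) (hm : m ≤ E.maxIdx)
    (h0 : I 0 (σ.putIdx a 0))
    (hI : ∀ l τ, l ≤ m → I l τ → τ.idx a = l ∧ τ.idx b = m)
    (hstep : ∀ l τ, l < m → I l τ → E.Runs c T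
      (fun ρ => ρ.idx a = l ∧ ρ.idx 3 = 1 ∧ I (l + 1) (ρ.putIdx a (l + 1))) τ)
    (hend : ∀ τ, I m τ → Post τ) :
    E.Runs (.for a b c) (loopSteps E.maxIdx T) Post σ := by
  -- Induction on the number `e` of rounds that remain.
  have key : ∀ e l τ, l + e = m → I l τ →
      E.Runs (.loop (.idxLt a b) (.seq c (.addIdx a a 3))) (e * (T + 2) + 1) Post τ := by
    intro e
    induction e with
    | zero =>
      intro l τ hl hτ hσ
      obtain rfl : l = m := by omega
      obtain ⟨h1, h2⟩ := hI l τ le_rfl hτ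
      refine ⟨τ, _, .loopFalse (by simp [Test.Holds, h1, h2]), ?_, hσ, hend τ hτ⟩
      have := hσ.test_cost (.idxLt a b)
      omega
    | succ e ih =>
      intro l τ hl hτ hσ
      obtain ⟨h1, h2⟩ := hI l τ (by omega) hτ
      obtain ⟨ρ, t, g1, g2, g3, g4, g5, g6⟩ := hstep l τ (by omega) hτ hσ
      have ha : E.Runs (.addIdx a a 3) 1 (fun ρ' => I (l + 1) ρ') ρ :=
        .addIdx (by omega) (by rwa [g4, g5])
      obtain ⟨ρ', t', a1, a2, a3, a4⟩ := ha g3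
      obtain ⟨ω, t'', b1, b2, b3, b4⟩ := ih (l + 1) ρ' (by omega) a4 a3
      refine ⟨ω, _, .loopTrue (by simp only [Test.Holds, h1, h2]; omega) (.seq g1 a1) b1, ?_,
        b3, b4⟩
      have := hσ.test_cost (.idxLt a b)
      have e1 : ((e + 1) * (T + 2) + 1) * E.unit =
        T * E.unit + E.unit + 1 * E.unit + (e * (T + 2) + 1) * E.unit := by ring
      omega
  have h1 : E.Runs (.for a b c) (1 + (m * (T + 2) + 1)) Post σ :=
    .seq (.setIdx (Nat.zero_le _) (key m 0 _ (by omega) h0))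
  refine h1.mono ?_ fun _ h => h
  have := Nat.mul_le_mul_right (T + 2) hm
  unfold loopSteps
  omega

end Logic

end FieldRAM

/-! ### Equilibria from dominant entries -/

section Equilibrium

/-- A strategy earns an average of pure payoffs, hence at most `v`, and exactly `v` when it uses
only actions that attain `v`. -/
theorem isNashEquilibrium_of_supports {r s : ℕ} {P Q : Matrix (Fin r) (Fin s) ℝ}
    {x : Fin r → ℝ} {y : Fin s → ℝ} (hx : IsMixedStrategy x) (hy : IsMixedStrategy y) {v w : ℝ}
    (hP : ∀ i, ∑ j, P i j * y j ≤ v) (hPx : ∀ i, x i ≠ 0 → ∑ j, P i j * y j = v)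
    (hQ : ∀ j, ∑ i, x i * Q i j ≤ w) (hQy : ∀ j, y j ≠ 0 → ∑ i, x i * Q i j = w) :
    IsNashEquilibrium P Q x y := by
  have eP : ∀ x', payoff P x' y = ∑ i, x' i * ∑ j, P i j * y j := fun x' => by
    simp only [payoff, Finset.mul_sum, mul_assoc]
  have eQ : ∀ y', payoff Q x y' = ∑ j, (∑ i, x i * Q i j) * y' j := fun y' => by
    simp only [payoff, Finset.sum_mul]
    exact Finset.sum_comm
  refine ⟨hx, hy, fun x' hx' => ?_, fun y' hy' => ?_⟩
  · have h1 : payoff P x y = v := by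
      rw [eP, ← one_mul v, ← hx.2, Finset.sum_mul]
      refine Finset.sum_congr rfl fun i _ => ?_
      by_cases h : x i = 0
      · simp [h]
      · rw [hPx i h]
    rw [h1, eP, ← one_mul v, ← hx'.2, Finset.sum_mul]
    exact Finset.sum_le_sum fun i _ => mul_le_mul_of_nonneg_left (hP i) (hx'.1 i)
  · have h1 : payoff Q x y = w := by
      rw [eQ, ← mul_one w, ← hy.2, Finset.mul_sum]
      refine Finset.sum_congr rfl fun i _ => ?_
      by_cases h : y i = 0
      · simp [h]
      · rw [hQy i h]
    rw [h1, eQ, ← mul_one w, ← hy'.2, Finset.mul_sum]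
    exact Finset.sum_le_sum fun i _ => mul_le_mul_of_nonneg_right (hQ i) (hy'.1 i)

variable {K : Type} [Field K] [LinearOrder K] [IsStrictOrderedRing K]

/-- The equilibrium is certified by finitely many equalities and inequalities between sums, which
can be checked in `K` and carried over to the reals. -/
theorem isNashEquilibrium_map (ι : K →+* ℝ) (hι : StrictMono ι) {r s : ℕ}
    {P Q : Matrix (Fin r) (Fin s) K} {x : Fin r → K} {y : Fin s → K}
    (hx : ∀ i, 0 ≤ x i) (hx1 : ∑ i, x i = 1) (hy : ∀ j, 0 ≤ y j) (hy1 : ∑ j, y j = 1) {v w : K}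
    (hP : ∀ i, ∑ j, P i j * y j ≤ v) (hPx : ∀ i, x i ≠ 0 → ∑ j, P i j * y j = v)
    (hQ : ∀ j, ∑ i, x i * Q i j ≤ w) (hQy : ∀ j, y j ≠ 0 → ∑ i, x i * Q i j = w) :
    IsNashEquilibrium (P.map ι) (Q.map ι) (fun i => ι (x i)) (fun j => ι (y j)) := by
  have h0 : ∀ a : K, 0 ≤ a → 0 ≤ ι a := fun a ha => by simpa using hι.monotone ha
  refine isNashEquilibrium_of_supports (v := ι v) (w := ι w) ⟨fun i => h0 _ (hx i), ?_⟩
    ⟨fun i => h0 _ (hy i), ?_⟩ (fun i => ?_) (fun i hi => ?_) (fun j => ?_) (fun j hj => ?_)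
  · rw [← map_sum, hx1, map_one]
  · rw [← map_sum, hy1, map_one]
  · simpa using hι.monotone (hP i)
  · rw [← hPx i (fun h => hi (by rw [h, map_zero]))]
    simp
  · simpa using hι.monotone (hQ j)
  · rw [← hQy j (fun h => hj (by rw [h, map_zero]))]
    simp

/-- The system of linear equations that makes the columns `β i` with `i ∈ S` equally good, and
takes the rows outside `S` out of the support. -/
def indiffMatrix {n m : ℕ} (Q : Matrix (Fin n) (Fin m) K) (β : Fin n → Fin m)
    (S : Finset (Fin n)) : Matrix (Fin n) (Fin n) K :=
  Matrix.of fun i i' => if i ∈ S then Q i' (β i) else (1 : Matrix (Fin n) (Fin n) K) i i'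

/-- The right-hand side of the system with the matrix `indiffMatrix`. -/
def indiffVec {n : ℕ} (S : Finset (Fin n)) (c : K) : Fin n → K := fun i => if i ∈ S then c else 0

/-- The entry in the column `β i` is more than `m - 1` times every other entry of row `i`. -/
def IsDominantChoice {n m : ℕ} (Q : Matrix (Fin n) (Fin m) K) (β : Fin n → Fin m) : Prop :=
  ∀ i j, j ≠ β i → ((m : K) - 1) * Q i j < Q i (β i)

variable {n m : ℕ} {Q : Matrix (Fin n) (Fin m) K} {β : Fin n → Fin m} {S : Finset (Fin n)}
  {x : Fin n → K} {c : K}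

/-- A second column is needed here: with `m = 1` dominance is vacuous and the chosen entry may be
zero. -/
theorem IsDominantChoice.pos (hQ : ∀ i j, 0 ≤ Q i j) (hm : 2 ≤ m) (hβ : IsDominantChoice Q β)
    (i : Fin n) : 0 < Q i (β i) := by
  have : Nontrivial (Fin m) := Fin.nontrivial_iff_two_le.2 hm
  obtain ⟨j, hj⟩ := exists_ne (β i)
  refine lt_of_le_of_lt (mul_nonneg ?_ (hQ i j)) (hβ i j hj)
  have : (2 : K) ≤ m := by exact_mod_cast hm
  linarith

theorem indiffMatrix_mulVec_of_notMem (h : (indiffMatrix Q β S).mulVec x = indiffVec S c)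
    {i : Fin n} (hi : i ∉ S) : x i = 0 := by
  have := congrFun h i
  simpa [indiffMatrix, indiffVec, Matrix.mulVec, dotProduct, hi, Matrix.one_apply] using this

theorem indiffMatrix_mulVec_of_mem (h : (indiffMatrix Q β S).mulVec x = indiffVec S c)
    {i : Fin n} (hi : i ∈ S) : ∑ i' ∈ S, Q i' (β i) * x i' = c := by
  have h1 := congrFun h i
  simp only [indiffMatrix, indiffVec, Matrix.mulVec, dotProduct, hi, Matrix.of_apply,
    if_true] at h1
  rw [← h1]
  refine Finset.sum_subset (Finset.subset_univ _) fun i' _ hi' => ?_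
  rw [indiffMatrix_mulVec_of_notMem h hi', mul_zero]

/-- Strict diagonal dominance in the unknowns `z`. A general right-hand side `c ≥ 0` is allowed
because `c = 0` gives nonsingularity and `c = 1` gives nonnegativity together with the bound needed
off the support. -/
theorem indiffMatrix_solution_mem (hQ : ∀ i j, 0 ≤ Q i j) (hm : 2 ≤ m)
    (hβ : IsDominantChoice Q β) (hS : Set.InjOn β S) (hc : 0 ≤ c)
    (h : (indiffMatrix Q β S).mulVec x = indiffVec S c) {i : Fin n} (hi : i ∈ S) :
    0 ≤ Q i (β i) * x i ∧ Q i (β i) * x i ≤ c := by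
  have hm' : (0 : K) < (m : K) - 1 := by
    have : (2 : K) ≤ m := by exact_mod_cast hm
    linarith
  have hpos := hβ.pos hQ hm
  set z : Fin n → K := fun i => Q i (β i) * x i with hz
  -- The claim says that `z` lies within `c / 2` of the centre `c / 2`; it suffices to bound the
  -- worst coordinate `p`.
  obtain ⟨p, hp, hmax⟩ := S.exists_max_image (fun i => |z i - c / 2|) ⟨i, hi⟩
  -- The coefficients of equation `p` in the unknowns `z`.
  set g : Fin n → K := fun i' => Q i' (β p) / Q i' (β i') with hg
  have hg0 : ∀ i', 0 ≤ g i' := fun i' => div_nonneg (hQ _ _) (hQ _ _)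
  have hgz : ∀ i', Q i' (β p) * x i' = g i' * z i' := fun i' => by
    have := (hpos i').ne'
    simp only [hg, hz]
    field_simp
  -- Injectivity makes `β p` a dominated column for each other row of `S`, so each term is below `1
  -- / (m - 1)`, and it also gives `|S| ≤ m`, so there are at most `m - 1` terms.
  have hθ : ∑ i' ∈ S.erase p, g i' < 1 := by
    rcases (S.erase p).eq_empty_or_nonempty with he | he
    · rw [he]; simp
    · have h1 : ∑ i' ∈ S.erase p, ((m : K) - 1) * g i' < ∑ i' ∈ S.erase p, (1 : K) := by
        refine Finset.sum_lt_sum_of_nonempty he fun i' hi' => ?_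
        have hne : β p ≠ β i' := fun e =>
          (Finset.ne_of_mem_erase hi') (hS (Finset.mem_of_mem_erase hi') hp e.symm)
        rw [hg, ← mul_div_assoc, div_lt_one (hpos i')]
        exact hβ i' _ hne
      rw [← Finset.mul_sum, Finset.sum_const, nsmul_eq_mul, mul_one] at h1
      have h2 : (S.erase p).card + 1 ≤ m := by
        rw [Finset.card_erase_add_one hp]
        simpa using Finset.card_le_card_of_injOn β (fun _ _ => Finset.mem_univ _) hS
      have h3 : ((S.erase p).card : K) + 1 ≤ m := by exact_mod_cast h2
      by_contra hcon
      push Not at hcon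
      nlinarith
  have hrow : z p + ∑ i' ∈ S.erase p, g i' * z i' = c := by
    rw [← indiffMatrix_mulVec_of_mem h hp, ← Finset.add_sum_erase S _ hp]
    simp only [hgz]
    rw [show g p = 1 from div_self (hpos p).ne', one_mul]
  set θ := ∑ i' ∈ S.erase p, g i' with hθdef
  have hsum : ∑ i' ∈ S.erase p, g i' * (z i' - c / 2)
      = ∑ i' ∈ S.erase p, g i' * z i' - θ * (c / 2) := by
    rw [hθdef, Finset.sum_mul, ← Finset.sum_sub_distrib]
    exact Finset.sum_congr rfl fun _ _ => by ring
  have habs : |∑ i' ∈ S.erase p, g i' * (z i' - c / 2)| ≤ θ * |z p - c / 2| := by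
    refine (Finset.abs_sum_le_sum_abs _ _).trans ?_
    rw [hθdef, Finset.sum_mul]
    refine Finset.sum_le_sum fun i' hi' => ?_
    rw [abs_mul, abs_of_nonneg (hg0 i')]
    exact mul_le_mul_of_nonneg_left (hmax i' (Finset.mem_of_mem_erase hi')) (hg0 i')
  -- Equation `p` relative to the centre. Since `θ < 1`, this inequality forces the deviation down
  -- to `c / 2`.
  have hle : |z p - c / 2| ≤ c / 2 * (1 - θ) + θ * |z p - c / 2| := by
    have e1 : z p - c / 2 = c / 2 * (1 - θ) - ∑ i' ∈ S.erase p, g i' * (z i' - c / 2) := by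
      rw [hsum]; linear_combination hrow
    have h0 : 0 ≤ c / 2 * (1 - θ) := mul_nonneg (by linarith) (by linarith)
    calc |z p - c / 2| = |c / 2 * (1 - θ) - ∑ i' ∈ S.erase p, g i' * (z i' - c / 2)| := by
          rw [← e1]
      _ ≤ |c / 2 * (1 - θ)| + |∑ i' ∈ S.erase p, g i' * (z i' - c / 2)| := abs_sub _ _
      _ ≤ _ := by rw [abs_of_nonneg h0]; linarith
  have hfin : |z p - c / 2| ≤ c / 2 := by
    by_contra hcon
    push Not at hcon
    nlinarith
  have := abs_le.1 ((hmax i hi).trans hfin)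
  constructor <;> linarith [this.1, this.2]

/-- A kernel vector solves the system with `c = 0`, which squeezes it to zero. -/
theorem det_indiffMatrix_ne_zero (hQ : ∀ i j, 0 ≤ Q i j) (hm : 2 ≤ m)
    (hβ : IsDominantChoice Q β) (hS : Set.InjOn β S) : (indiffMatrix Q β S).det ≠ 0 := by
  intro hdet
  obtain ⟨x, hx0, hx⟩ := Matrix.exists_mulVec_eq_zero_iff.2 hdet
  have h : (indiffMatrix Q β S).mulVec x = indiffVec S 0 := by
    rw [hx]; funext i; simp [indiffVec]
  refine hx0 (funext fun i => ?_)
  by_cases hi : i ∈ S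
  · have := indiffMatrix_solution_mem hQ hm hβ hS le_rfl h hi
    have h0 : Q i (β i) * x i = 0 := le_antisymm this.2 this.1
    exact (mul_eq_zero.1 h0).resolve_left (hβ.pos hQ hm i).ne'
  · exact indiffMatrix_mulVec_of_notMem h hi

theorem indiffMatrix_solution_nonneg (hQ : ∀ i j, 0 ≤ Q i j) (hm : 2 ≤ m)
    (hβ : IsDominantChoice Q β) (hS : Set.InjOn β S)
    (h : (indiffMatrix Q β S).mulVec x = indiffVec S 1) (i : Fin n) : 0 ≤ x i := by
  by_cases hi : i ∈ S
  · have := indiffMatrix_solution_mem hQ hm hβ hS zero_le_one h hi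
    exact nonneg_of_mul_nonneg_right this.1 (hβ.pos hQ hm i)
  · exact (indiffMatrix_mulVec_of_notMem h hi).ge

theorem indiffMatrix_solution_payoff_eq (h : (indiffMatrix Q β S).mulVec x = indiffVec S 1)
    {i : Fin n} (hi : i ∈ S) : ∑ i', x i' * Q i' (β i) = 1 := by
  rw [← indiffMatrix_mulVec_of_mem h hi]
  symm
  simp only [mul_comm (x _)]
  refine Finset.sum_subset (Finset.subset_univ _) fun i' _ hi' => ?_
  rw [indiffMatrix_mulVec_of_notMem h hi', mul_zero]

/-- Against a column outside the image of `S`, row `i` contributes at most `z i / (m - 1) ≤ 1 / (m -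
1)`. -/
theorem indiffMatrix_solution_payoff_le (hQ : ∀ i j, 0 ≤ Q i j) (hm : 2 ≤ m)
    (hβ : IsDominantChoice Q β) (hS : Set.InjOn β S)
    (h : (indiffMatrix Q β S).mulVec x = indiffVec S 1) (j : Fin m) :
    ∑ i, x i * Q i j ≤ 1 := by
  by_cases hj : ∃ i ∈ S, β i = j
  · obtain ⟨i, hi, rfl⟩ := hj
    exact (indiffMatrix_solution_payoff_eq h hi).le
  · push Not at hj
    have hm' : (0 : K) < (m : K) - 1 := by
      have : (2 : K) ≤ m := by exact_mod_cast hm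
      linarith
    have h1 : ∑ i, x i * Q i j = ∑ i ∈ S, x i * Q i j := by
      symm
      refine Finset.sum_subset (Finset.subset_univ _) fun i' _ hi' => ?_
      rw [indiffMatrix_mulVec_of_notMem h hi', zero_mul]
    have h2 : ((m : K) - 1) * ∑ i, x i * Q i j ≤ S.card := by
      rw [h1, Finset.mul_sum, Finset.cast_card]
      refine Finset.sum_le_sum fun i hi => ?_
      have h3 := indiffMatrix_solution_nonneg hQ hm hβ hS h i
      have h4 := (indiffMatrix_solution_mem hQ hm hβ hS zero_le_one h hi).2
      have h5 := hβ i j (hj i hi).symm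
      nlinarith
    -- `β` embeds `S` into the columns other than `j`.
    have h3 : S.card + 1 ≤ m := by
      have : S.card < (Finset.univ : Finset (Fin m)).card := by
        rw [← Finset.card_image_of_injOn hS]
        refine Finset.card_lt_card (Finset.ssubset_univ_iff.2 fun e => ?_)
        have := Finset.mem_univ j
        rw [← e, Finset.mem_image] at this
        obtain ⟨i, hi, e⟩ := this
        exact hj i hi e
      simpa using this
    have h4 : (S.card : K) + 1 ≤ m := by exact_mod_cast h3
    by_contra hcon
    push Not at hcon
    nlinarith

/-- If the sum vanished, so would all `x i`, and a supported column could not earn `1`. This permits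
normalization. -/
theorem indiffMatrix_solution_sum_pos (hQ : ∀ i j, 0 ≤ Q i j) (hm : 2 ≤ m)
    (hβ : IsDominantChoice Q β) (hS : Set.InjOn β S) (hne : S.Nonempty)
    (h : (indiffMatrix Q β S).mulVec x = indiffVec S 1) : 0 < ∑ i, x i := by
  have h0 := indiffMatrix_solution_nonneg hQ hm hβ hS h
  refine lt_of_le_of_ne (Finset.sum_nonneg fun i _ => h0 i) fun e => ?_
  obtain ⟨i, hi⟩ := hne
  have h1 := indiffMatrix_solution_payoff_eq h hi
  have h2 := (Finset.sum_eq_zero_iff_of_nonneg fun i _ => h0 i).1 e.symm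
  rw [Finset.sum_eq_zero fun i' hi' => by rw [h2 i' hi', zero_mul]] at h1
  exact zero_ne_one h1

/-- Two sets of rows and columns that are mapped onto each other by the dominant choices of both
players support an equilibrium. -/
theorem isNashEquilibrium_of_indiffMatrix (ι : K →+* ℝ) (hι : StrictMono ι) {r s : ℕ}
    (hr : 2 ≤ r) (hs : 2 ≤ s) {P Q : Matrix (Fin r) (Fin s) K} (hP : ∀ i j, 0 ≤ P i j)
    (hQ : ∀ i j, 0 ≤ Q i j) {α : Fin s → Fin r} {β : Fin r → Fin s}
    (hα : IsDominantChoice P.transpose α) (hβ : IsDominantChoice Q β)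
    {S : Finset (Fin r)} {T : Finset (Fin s)} (hS : Set.InjOn β S) (hT : Set.InjOn α T)
    (hne : S.Nonempty) (hST : S.image β = T) (hTS : T.image α = S)
    {x : Fin r → K} {y : Fin s → K} (hx : (indiffMatrix Q β S).mulVec x = indiffVec S 1)
    (hy : (indiffMatrix P.transpose α T).mulVec y = indiffVec T 1) :
    IsNashEquilibrium (P.map ι) (Q.map ι) (fun i => ι (x i / ∑ k, x k))
      (fun j => ι (y j / ∑ k, y k)) := by
  have hP' : ∀ i j, 0 ≤ P.transpose i j := fun i j => hP j i
  have hneT : T.Nonempty := hST ▸ hne.image β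
  have px := indiffMatrix_solution_sum_pos hQ hs hβ hS hne hx
  have py := indiffMatrix_solution_sum_pos hP' hr hα hT hneT hy
  have eP : ∀ i, ∑ j, P i j * (y j / ∑ k, y k) = (∑ j, y j * P.transpose j i) / ∑ k, y k :=
    fun i => by
      rw [Finset.sum_div]
      exact Finset.sum_congr rfl fun j _ => by rw [Matrix.transpose_apply]; ring
  have eQ : ∀ j, ∑ i, x i / (∑ k, x k) * Q i j = (∑ i, x i * Q i j) / ∑ k, x k :=
    fun j => by
      rw [Finset.sum_div]
      exact Finset.sum_congr rfl fun i _ => by ring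
  refine isNashEquilibrium_map ι hι (v := 1 / ∑ k, y k) (w := 1 / ∑ k, x k)
    (fun i => div_nonneg (indiffMatrix_solution_nonneg hQ hs hβ hS hx i) px.le) ?_
    (fun j => div_nonneg (indiffMatrix_solution_nonneg hP' hr hα hT hy j) py.le) ?_
    (fun i => ?_) (fun i hi => ?_) (fun j => ?_) (fun j hj => ?_)
  · rw [← Finset.sum_div, div_self px.ne']
  · rw [← Finset.sum_div, div_self py.ne']
  · rw [eP]
    exact div_le_div_of_nonneg_right (indiffMatrix_solution_payoff_le hP' hr hα hT hy i) py.le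
  · have hi' : i ∈ S := by
      by_contra hn
      exact hi (by rw [indiffMatrix_mulVec_of_notMem hx hn, zero_div])
    rw [← hTS] at hi'
    obtain ⟨j, hj, rfl⟩ := Finset.mem_image.1 hi'
    rw [eP, indiffMatrix_solution_payoff_eq hy hj]
  · rw [eQ]
    exact div_le_div_of_nonneg_right (indiffMatrix_solution_payoff_le hQ hs hβ hS hx j) px.le
  · have hj' : j ∈ T := by
      by_contra hn
      exact hj (by rw [indiffMatrix_mulVec_of_notMem hy hn, zero_div])
    rw [← hST] at hj'
    obtain ⟨i, hi, rfl⟩ := Finset.mem_image.1 hj'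
    rw [eQ, indiffMatrix_solution_payoff_eq hx hi]

theorem isNashEquilibrium_pure (ι : K →+* ℝ) (hι : StrictMono ι) {r s : ℕ}
    {P Q : Matrix (Fin r) (Fin s) K} {i : Fin r} {j : Fin s} (hP : ∀ k, P k j ≤ P i j)
    (hQ : ∀ k, Q i k ≤ Q i j) :
    IsNashEquilibrium (P.map ι) (Q.map ι) (fun k => ι (if k = i then 1 else 0))
      (fun k => ι (if k = j then 1 else 0)) := by
  refine isNashEquilibrium_map ι hι (v := P i j) (w := Q i j) (fun k => ?_) (by simp)
    (fun k => ?_) (by simp) (fun k => by simpa using hP k) (fun k hk => ?_)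
    (fun k => by simpa using hQ k) (fun k hk => ?_)
  · split <;> simp
  · split <;> simp
  · obtain rfl : k = i := by simpa using hk
    simp
  · obtain rfl : k = j := by simpa using hk
    simp

/-- In a column with a dominant entry, every largest entry is dominant. -/
theorem HasDominantColumnEntries.isDominantChoice {ι : K →+* ℝ} (hι : StrictMono ι)
    {A : Matrix (Fin n) (Fin m) K} (hA : ∀ i j, 0 ≤ A i j) (hm : 2 ≤ m)
    (h : HasDominantColumnEntries (A.map ι).transpose)
    (hβ : ∀ i j, A i j ≤ A i (β i)) : IsDominantChoice A β := by
  intro i j hj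
  obtain ⟨j₀, h₀⟩ := h i
  have h1 : ∀ k, k ≠ j₀ → ((m : K) - 1) * A i k < A i j₀ := fun k hk => by
    have := h₀ k hk
    rw [← hι.lt_iff_lt]
    simpa using this
  suffices e : β i = j₀ by rw [e]; exact h1 j (e ▸ hj)
  -- Otherwise `m - 1 ≥ 1` times the largest entry would be less than `A i j₀`, which is at most
  -- that entry.
  by_contra hne
  have h2 := h1 _ hne
  have h3 := hβ i j₀
  have h4 := hA i (β i)
  have : (2 : K) ≤ m := by exact_mod_cast hm
  nlinarith

end Equilibrium

/-! ### Replacing a row of a matrix -/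

section UpdateRow

variable {K : Type} [Field K] {n : ℕ} {A : Matrix (Fin n) (Fin n) K} {i : Fin n} {a : Fin n → K}

/-- If the pivot were zero, column `i` of `A⁻¹` would be a nonzero kernel vector of the updated
matrix: the unchanged rows of `A` annihilate it, and the pivot is its product with the new row. -/
theorem updateRow_pivot_ne_zero (hA : A.det ≠ 0) (hA' : (A.updateRow i a).det ≠ 0) :
    ∑ l, a l * A⁻¹ l i ≠ 0 := by
  intro h0
  have h1 : A * A⁻¹ = 1 := Matrix.mul_nonsing_inv A (isUnit_iff_ne_zero.2 hA)
  have h2 : (A.updateRow i a).mulVec (fun l => A⁻¹ l i) = 0 := by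
    funext k
    by_cases hk : k = i
    · subst hk
      simpa [Matrix.mulVec, dotProduct] using h0
    · have := congrFun (congrFun h1 k) i
      rw [Matrix.mul_apply, Matrix.one_apply_ne hk] at this
      simpa [Matrix.mulVec, dotProduct, hk] using this
  have h3 : (fun l => A⁻¹ l i) = 0 := Matrix.eq_zero_of_mulVec_eq_zero hA' h2
  have h4 := congrFun (congrFun h1 i) i
  rw [Matrix.mul_apply, Matrix.one_apply_eq,
    Finset.sum_eq_zero fun l _ => by rw [show A⁻¹ l i = 0 from congrFun h3 l, mul_zero]] at h4
  exact zero_ne_one h4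

/-- The Sherman–Morrison formula for a row replacement, organized as column operations: scale column
`i` by the pivot, then clear the product of the new row with every other column. -/
theorem updateRow_inv_apply (hA : A.det ≠ 0) (hA' : (A.updateRow i a).det ≠ 0) (l k : Fin n) :
    (A.updateRow i a)⁻¹ l k = if k = i then A⁻¹ l i / ∑ l, a l * A⁻¹ l i
      else A⁻¹ l k - (∑ l, a l * A⁻¹ l k) * (A⁻¹ l i / ∑ l, a l * A⁻¹ l i) := by
  have hp := updateRow_pivot_ne_zero hA hA'
  have h1 : A * A⁻¹ = 1 := Matrix.mul_nonsing_inv A (isUnit_iff_ne_zero.2 hA)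
  have h1' : ∀ q k, ∑ l, A q l * A⁻¹ l k = (1 : Matrix (Fin n) (Fin n) K) q k := fun q k => by
    rw [← h1, Matrix.mul_apply]
  set p := ∑ l, a l * A⁻¹ l i with hpdef
  suffices h : A.updateRow i a * Matrix.of (fun l k => if k = i then A⁻¹ l i / p
      else A⁻¹ l k - (∑ l, a l * A⁻¹ l k) * (A⁻¹ l i / p)) = 1 by
    rw [Matrix.inv_eq_right_inv h, Matrix.of_apply]
  have hdiv : ∀ v : Fin n → K, ∑ l, v l * (A⁻¹ l i / p) = (∑ l, v l * A⁻¹ l i) / p := fun v => by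
    rw [Finset.sum_div]
    exact Finset.sum_congr rfl fun _ _ => by ring
  have hgen : ∀ (v : Fin n → K) (k : Fin n) (w : K),
      ∑ l, v l * (A⁻¹ l k - w * (A⁻¹ l i / p)) =
        ∑ l, v l * A⁻¹ l k - w * ((∑ l, v l * A⁻¹ l i) / p) := fun v k w => by
    rw [← hdiv, Finset.mul_sum, ← Finset.sum_sub_distrib]
    exact Finset.sum_congr rfl fun _ _ => by ring
  ext q k
  rw [Matrix.mul_apply]
  simp only [Matrix.of_apply]
  by_cases hk : k = i
  · subst hk
    simp only [if_true, hdiv]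
    by_cases hq : q = k
    · subst hq
      simp only [Matrix.updateRow_self, ← hpdef, Matrix.one_apply_eq, div_self hp]
    · simp only [Matrix.updateRow_ne hq, h1', Matrix.one_apply_ne hq, zero_div]
  · simp only [hk, if_false, hgen]
    by_cases hq : q = i
    · subst hq
      simp only [Matrix.updateRow_self, ← hpdef, Matrix.one_apply_ne (Ne.symm hk), div_self hp,
        mul_one, sub_self]
    · simp only [Matrix.updateRow_ne hq, h1', Matrix.one_apply_ne hq, zero_div, mul_zero, sub_zero]

/-- The old solution already satisfies the unchanged equations. Moving along column `i` of the
inverse preserves them and corrects the new one. -/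
theorem updateRow_inv_mulVec (hA : A.det ≠ 0) (hA' : (A.updateRow i a).det ≠ 0)
    (b : Fin n → K) (c : K) (l : Fin n) :
    ((A.updateRow i a)⁻¹.mulVec (Function.update b i c)) l =
      A⁻¹.mulVec b l - (∑ l, a l * A⁻¹.mulVec b l - c) *
        (A⁻¹ l i / ∑ l, a l * A⁻¹ l i) := by
  have hp := updateRow_pivot_ne_zero hA hA'
  have h1 : A * A⁻¹ = 1 := Matrix.mul_nonsing_inv A (isUnit_iff_ne_zero.2 hA)
  have h1' : ∀ q k, ∑ l, A q l * A⁻¹ l k = (1 : Matrix (Fin n) (Fin n) K) q k := fun q k => by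
    rw [← h1, Matrix.mul_apply]
  have h2 : A.mulVec (A⁻¹.mulVec b) = b := by rw [Matrix.mulVec_mulVec, h1, Matrix.one_mulVec]
  set p := ∑ l, a l * A⁻¹ l i with hpdef
  set x := A⁻¹.mulVec b with hx
  set w := ∑ l, a l * x l - c with hw
  have hgen : ∀ (v : Fin n → K),
      ∑ l, v l * (x l - w * (A⁻¹ l i / p)) =
        ∑ l, v l * x l - w * ((∑ l, v l * A⁻¹ l i) / p) := fun v => by
    rw [Finset.sum_div, Finset.mul_sum, ← Finset.sum_sub_distrib]
    exact Finset.sum_congr rfl fun _ _ => by ring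
  have h3 : (A.updateRow i a).mulVec (fun l => x l - w * (A⁻¹ l i / p)) =
      Function.update b i c := by
    funext q
    simp only [Matrix.mulVec, dotProduct, hgen]
    by_cases hq : q = i
    · subst hq
      simp only [Matrix.updateRow_self, ← hpdef, Function.update_self, div_self hp, hw]
      ring
    · simp only [Matrix.updateRow_ne hq, h1', Matrix.one_apply_ne hq, zero_div, mul_zero, sub_zero,
        Function.update_of_ne hq]
      exact congrFun h2 q
  rw [← h3, Matrix.mulVec_mulVec, Matrix.nonsing_inv_mul _ (isUnit_iff_ne_zero.2 hA'),
    Matrix.one_mulVec]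

variable {m : ℕ}

theorem indiffMatrix_insert (Q : Matrix (Fin n) (Fin m) K) (β : Fin n → Fin m)
    (S : Finset (Fin n)) (i : Fin n) : indiffMatrix Q β (insert i S) =
      (indiffMatrix Q β S).updateRow i (fun i' => Q i' (β i)) := by
  ext q k
  by_cases hq : q = i
  · subst hq
    simp [indiffMatrix]
  · simp [indiffMatrix, hq]

theorem indiffVec_insert (S : Finset (Fin n)) (i : Fin n) (c : K) :
    indiffVec (insert i S) c = Function.update (indiffVec S c) i c := by
  funext q
  by_cases hq : q = i
  · subst hq
    simp [indiffVec]
  · simp [indiffVec, hq]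

end UpdateRow

/-! ### Sizes of numbers -/

namespace FieldRAM

/-- A bound for the number of bits of the entries of the inverse of an `n × n` matrix whose
entries have at most `N` bits. -/
def invBits (n N : ℕ) : ℕ := N * n ^ 2 + n ^ 2 + n * (N * (n ^ 2 + 1))

/-- A family of bounds for the sizes of numbers that is compatible with the arithmetic operations
and with matrix inversion. -/
structure SizeScale (K : Type) [Field K] (sz : K → ℕ) where
  Small : ℕ → K → Prop
  mono : ∀ {N M x}, N ≤ M → Small N x → Small M x
  zero : Small 0 0
  one : Small 0 1
  add : ∀ {N M x y}, Small N x → Small M y → Small (N + M + 1) (x + y)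
  sub : ∀ {N M x y}, Small N x → Small M y → Small (N + M + 1) (x - y)
  mul : ∀ {N M x y}, Small N x → Small M y → Small (N + M) (x * y)
  div : ∀ {N M x y}, Small N x → Small M y → Small (N + M) (x / y)
  sz_le : ∀ {N x}, Small N x → sz x ≤ 2 * N + 3
  inv : ∀ {n N : ℕ} {A : Matrix (Fin n) (Fin n) K}, (∀ i j, Small N (A i j)) → A.det ≠ 0 →
    ∀ i j, Small (invBits n N) (A⁻¹ i j)

theorem SizeScale.sum_range {K : Type} [Field K] {sz : K → ℕ} (Z : SizeScale K sz) {N : ℕ}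
    {f : ℕ → K} {n m : ℕ} (hf : ∀ l < n, Z.Small N (f l)) (hn : n ≤ m) :
    Z.Small (m * (N + 1)) (∑ l ∈ Finset.range n, f l) := by
  refine Z.mono (Nat.mul_le_mul_right _ hn) ?_
  clear hn
  induction n with
  | zero => simpa using Z.zero
  | succ n ih =>
    rw [Finset.sum_range_succ]
    refine Z.mono ?_ (Z.add (ih fun l hl => hf l (by omega)) (hf n (by omega)))
    ring_nf
    omega

/-- All real numbers have size zero. -/
def realScale : SizeScale ℝ unitSize where
  Small := fun _ _ => True
  mono := fun _ _ => trivial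
  zero := trivial
  one := trivial
  add := fun _ _ => trivial
  sub := fun _ _ => trivial
  mul := fun _ _ => trivial
  div := fun _ _ => trivial
  sz_le := fun _ => Nat.zero_le _
  inv := fun _ _ _ _ => trivial

/-- `x` is a fraction whose numerator and denominator are at most `2 ^ N`. -/
def FracBound (N : ℕ) (x : ℚ) : Prop :=
  ∃ a b : ℤ, b ≠ 0 ∧ |a| ≤ 2 ^ N ∧ |b| ≤ 2 ^ N ∧ x = a / b

theorem FracBound.mono {N M : ℕ} {x : ℚ} (h : N ≤ M) (hx : FracBound N x) : FracBound M x := by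
  obtain ⟨a, b, hb, ha, hb', rfl⟩ := hx
  have : (2 : ℤ) ^ N ≤ 2 ^ M := pow_le_pow_right₀ (by norm_num) h
  exact ⟨a, b, hb, ha.trans this, hb'.trans this, rfl⟩

/-- Fractions need not be reduced, so cross-multiplication gives the bound; the extra bit pays for
adding the two products. -/
theorem FracBound.add {N M : ℕ} {x y : ℚ} (hx : FracBound N x) (hy : FracBound M y) :
    FracBound (N + M + 1) (x + y) := by
  obtain ⟨a, b, hb, ha, hb', rfl⟩ := hx
  obtain ⟨c, d, hd, hc, hd', rfl⟩ := hy
  have hp : (0 : ℤ) < 2 ^ N * 2 ^ M := by positivity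
  have e : (2 : ℤ) ^ (N + M + 1) = 2 * (2 ^ N * 2 ^ M) := by ring
  refine ⟨a * d + b * c, b * d, mul_ne_zero hb hd, ?_, ?_, ?_⟩
  · have h1 : |a * d| ≤ 2 ^ N * 2 ^ M := by rw [abs_mul]; gcongr
    have h2 : |b * c| ≤ 2 ^ N * 2 ^ M := by rw [abs_mul]; gcongr
    have := abs_add_le (a * d) (b * c)
    linarith
  · have h1 : |b * d| ≤ 2 ^ N * 2 ^ M := by rw [abs_mul]; gcongr
    linarith
  · have : (b : ℚ) ≠ 0 := by exact_mod_cast hb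
    have : (d : ℚ) ≠ 0 := by exact_mod_cast hd
    push_cast
    field_simp

theorem FracBound.neg {N : ℕ} {x : ℚ} (hx : FracBound N x) : FracBound N (-x) := by
  obtain ⟨a, b, hb, ha, hb', rfl⟩ := hx
  exact ⟨-a, b, hb, by rwa [abs_neg], hb', by push_cast; ring⟩

theorem FracBound.mul {N M : ℕ} {x y : ℚ} (hx : FracBound N x) (hy : FracBound M y) :
    FracBound (N + M) (x * y) := by
  obtain ⟨a, b, hb, ha, hb', rfl⟩ := hx
  obtain ⟨c, d, hd, hc, hd', rfl⟩ := hy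
  refine ⟨a * c, b * d, mul_ne_zero hb hd, ?_, ?_, ?_⟩
  · rw [abs_mul, pow_add]; gcongr
  · rw [abs_mul, pow_add]; gcongr
  · push_cast
    rw [div_mul_div_comm]

theorem FracBound.zero (N : ℕ) : FracBound N 0 :=
  ⟨0, 1, one_ne_zero, by simp, by simpa using one_le_pow₀ (by norm_num), by simp⟩

theorem FracBound.inv {N : ℕ} {x : ℚ} (hx : FracBound N x) : FracBound N x⁻¹ := by
  obtain ⟨a, b, hb, ha, hb', rfl⟩ := hx
  by_cases h : a = 0
  · subst h
    simpa using FracBound.zero N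
  · exact ⟨b, a, h, hb', ha, by rw [inv_div]⟩

theorem fracBound_bitSize (x : ℚ) : FracBound (bitSize x) x := by
  have key : ∀ a b : ℕ, a = Nat.size b → ∀ N, a ≤ N → (b : ℤ) ≤ 2 ^ N := fun a b e N h => by
    have h1 : b < 2 ^ N := Nat.size_le.1 (e ▸ h)
    exact_mod_cast h1.le
  refine ⟨x.num, x.den, by exact_mod_cast x.den_nz, ?_, ?_, ?_⟩
  · rw [← Int.natCast_natAbs]
    exact key _ _ rfl _ (by unfold bitSize; omega)
  · rw [Nat.abs_cast]
    exact key _ _ rfl _ (by unfold bitSize; omega)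
  · exact_mod_cast (Rat.num_div_den x).symm

/-- Reduction only decreases numerator and denominator. Each has at most `N + 1` bits, and the sign
takes one more. -/
theorem FracBound.bitSize_le {N : ℕ} {x : ℚ} (hx : FracBound N x) : bitSize x ≤ 2 * N + 3 := by
  obtain ⟨a, b, hb, ha, hb', rfl⟩ := hx
  have key : ∀ (k : ℕ) (c : ℤ), |c| ≤ 2 ^ N → k ≤ c.natAbs → Nat.size k ≤ N + 1 := fun k c hc h => by
    rw [Nat.size_le, pow_succ]
    have h1 : (c.natAbs : ℤ) ≤ 2 ^ N := by rwa [Int.natCast_natAbs]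
    have h2 : c.natAbs ≤ 2 ^ N := by exact_mod_cast h1
    have : 0 < 2 ^ N := by positivity
    omega
  have h1 : Nat.size ((a : ℚ) / b).den ≤ N + 1 := by
    refine key _ b hb' (Nat.le_of_dvd (Int.natAbs_pos.2 hb) ?_)
    have := Rat.den_dvd a b
    rw [Rat.divInt_eq_div] at this
    exact Int.natCast_dvd.1 this
  have h2 : Nat.size ((a : ℚ) / b).num.natAbs ≤ N + 1 := by
    by_cases h0 : a = 0
    · subst h0; simp
    · refine key _ a ha (Nat.le_of_dvd (Int.natAbs_pos.2 h0) ?_)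
      have := Rat.num_dvd a hb
      rw [Rat.divInt_eq_div] at this
      exact Int.natAbs_dvd_natAbs.2 this
  unfold bitSize
  omega

/-- Leibniz expansion, with `n! ≤ n ^ n ≤ 2 ^ (n ^ 2)`. -/
theorem abs_det_le_two_pow {n H : ℕ} {A : Matrix (Fin n) (Fin n) ℤ}
    (hA : ∀ i j, |A i j| ≤ 2 ^ H) : |A.det| ≤ 2 ^ (n ^ 2 + n * H) := by
  have h1 := Matrix.det_le (abv := AbsoluteValue.abs) (x := 2 ^ H) (A := A) hA
  have h2 : (n.factorial : ℤ) ≤ 2 ^ (n ^ 2) := by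
    have : n.factorial ≤ 2 ^ (n ^ 2) := by
      calc n.factorial ≤ n ^ n := Nat.factorial_le_pow n
        _ ≤ (2 ^ n) ^ n := Nat.pow_le_pow_left Nat.lt_two_pow_self.le _
        _ = 2 ^ (n ^ 2) := by rw [← pow_mul, sq]
    exact_mod_cast this
  have h3 : |A.det| ≤ n.factorial * (2 ^ H) ^ n := by simpa using h1
  calc |A.det| ≤ n.factorial * (2 ^ H) ^ n := h3
    _ ≤ 2 ^ (n ^ 2) * (2 ^ H) ^ n := by gcongr
    _ = _ := by rw [← pow_mul, ← pow_add, mul_comm H]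

/-- Clear denominators and apply Cramer's rule to the integer matrix `Z = D • A`. The three terms of
`invBits` come from `D`, from the factorial, and from the entries in a determinant. -/
theorem FracBound.matrix_inv {n N : ℕ} {A : Matrix (Fin n) (Fin n) ℚ}
    (hA : ∀ i j, FracBound N (A i j)) (hdet : A.det ≠ 0) (i j : Fin n) :
    FracBound (invBits n N) (A⁻¹ i j) := by
  choose a b hb ha hb' hab using hA
  -- The product of all `n ^ 2` denominators is a common denominator with at most `N * n ^ 2` bits;
  -- a least one is not needed.
  set D : ℤ := ∏ p : Fin n × Fin n, b p.1 p.2 with hD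
  have hD0 : D ≠ 0 := Finset.prod_ne_zero_iff.2 fun p _ => hb _ _
  have hrest : ∀ s : Finset (Fin n × Fin n), |∏ p ∈ s, b p.1 p.2| ≤ 2 ^ (N * n ^ 2) := fun s => by
    rw [Finset.abs_prod]
    calc ∏ p ∈ s, |b p.1 p.2| ≤ ∏ _p ∈ s, (2 : ℤ) ^ N :=
          Finset.prod_le_prod (fun _ _ => abs_nonneg _) fun p _ => hb' _ _
      _ = 2 ^ (N * s.card) := by rw [Finset.prod_const, pow_mul]
      _ ≤ 2 ^ (N * n ^ 2) := by
          refine pow_le_pow_right₀ (by norm_num) (Nat.mul_le_mul_left _ ?_)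
          have := Finset.card_le_univ s
          rwa [Fintype.card_prod, Fintype.card_fin, ← sq] at this
  set Z : Matrix (Fin n) (Fin n) ℤ :=
    Matrix.of fun i j => a i j * ∏ p ∈ Finset.univ.erase (i, j), b p.1 p.2 with hZ
  have hZb : ∀ i j, |Z i j| ≤ 2 ^ (N * (n ^ 2 + 1)) := fun i j => by
    rw [hZ, Matrix.of_apply, abs_mul, mul_add, mul_one, pow_add, mul_comm]
    gcongr
    · exact hrest _
    · exact ha i j
  have hZA : Z.map (Int.castRingHom ℚ) = (D : ℚ) • A := by
    ext i j
    have h1 : (b i j : ℚ) ≠ 0 := by exact_mod_cast hb i j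
    have h2 : D = b i j * ∏ p ∈ Finset.univ.erase (i, j), b p.1 p.2 :=
      (Finset.mul_prod_erase Finset.univ (fun p : Fin n × Fin n => b p.1 p.2)
        (Finset.mem_univ (i, j))).symm
    simp only [hZ, Matrix.map_apply, Matrix.of_apply, Matrix.smul_apply, smul_eq_mul, hab i j, h2]
    simp only [map_mul, eq_intCast, Int.cast_mul]
    field_simp
  have hDq : (D : ℚ) ≠ 0 := by exact_mod_cast hD0
  have hdetZ : ((Z.det : ℤ) : ℚ) = (D : ℚ) ^ n * A.det := by
    have := (Int.castRingHom ℚ).map_det Z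
    rw [RingHom.mapMatrix_apply, hZA, Matrix.det_smul, Fintype.card_fin] at this
    simpa using this
  have hdetZ0 : Z.det ≠ 0 := by
    intro h
    rw [h] at hdetZ
    exact mul_ne_zero (pow_ne_zero _ hDq) hdet (by simpa using hdetZ.symm)
  have hadj : ((D : ℚ) • A) * (Z.adjugate.map (Int.castRingHom ℚ)) =
      (Z.det : ℚ) • (1 : Matrix (Fin n) (Fin n) ℚ) := by
    rw [← hZA, ← Matrix.map_mul, Matrix.mul_adjugate]
    ext i j
    rw [Matrix.map_apply, Matrix.smul_apply, Matrix.smul_apply, Matrix.one_apply, Matrix.one_apply]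
    split <;> simp
  have hdq : (Z.det : ℚ) ≠ 0 := by exact_mod_cast hdetZ0
  have hinv : A⁻¹ = ((D : ℚ) / Z.det) • Z.adjugate.map (Int.castRingHom ℚ) := by
    refine Matrix.inv_eq_right_inv ?_
    rw [Matrix.smul_mul] at hadj
    rw [Matrix.mul_smul, div_eq_inv_mul, mul_smul, hadj, smul_smul, inv_mul_cancel₀ hdq, one_smul]
  refine ⟨D * Z.adjugate i j, Z.det, hdetZ0, ?_, ?_, ?_⟩
  · have h1 : |Z.adjugate i j| ≤ 2 ^ (n ^ 2 + n * (N * (n ^ 2 + 1))) := by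
      rw [Matrix.adjugate_apply]
      refine abs_det_le_two_pow fun k l => ?_
      by_cases hk : k = j
      · subst hk
        rw [Matrix.updateRow_self, Pi.single_apply]
        split
        · simpa using one_le_pow₀ (by norm_num)
        · simp
      · rw [Matrix.updateRow_ne hk]
        exact hZb k l
    rw [abs_mul, invBits, add_assoc, pow_add]
    gcongr
    exact hrest _
  · refine (abs_det_le_two_pow hZb).trans (pow_le_pow_right₀ (by norm_num) ?_)
    unfold invBits
    omega
  · rw [hinv]
    simp only [Matrix.smul_apply, Matrix.map_apply, smul_eq_mul, eq_intCast, Int.cast_mul]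
    ring

/-- The bit sizes of rational numbers. -/
def ratScale : SizeScale ℚ bitSize where
  Small := FracBound
  mono := FracBound.mono
  zero := FracBound.zero 0
  one := ⟨1, 1, one_ne_zero, by simp, by simp, by simp⟩
  add := FracBound.add
  sub := fun hx hy => by simpa [sub_eq_add_neg] using hx.add hy.neg
  mul := FracBound.mul
  div := fun hx hy => by simpa [div_eq_mul_inv] using hx.mul hy.inv
  sz_le := FracBound.bitSize_le
  inv := FracBound.matrix_inv

end FieldRAM

/-! ### Subprograms

The registers `2` and `3` contain `0` and `1`, the registers `6` and `7` are counters of inner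
loops, and the entries at the origin of the arrays `7` and `8` are an accumulator and a temporary
variable. -/

namespace FieldRAM

section Subprograms

variable {K : Type}

/-- The stores `σ` and `τ` agree outside the registers in `R` and the arrays in `M`. -/
structure Store.Frame (R M : Set ℕ) (σ τ : Store K) : Prop where
  idx : ∀ a ∉ R, τ.idx a = σ.idx a
  num : ∀ A ∉ M, τ.num A = σ.num A

theorem Store.Frame.refl (R M : Set ℕ) (σ : Store K) : Store.Frame R M σ σ :=
  ⟨fun _ _ => rfl, fun _ _ => rfl⟩

theorem Store.Frame.trans {R M R' M' R'' M'' : Set ℕ} {σ τ ρ : Store K} (h : Frame R M σ τ)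
    (h' : Frame R' M' τ ρ) (h₁ : R ⊆ R'') (h₂ : M ⊆ M'') (h₃ : R' ⊆ R'') (h₄ : M' ⊆ M'') :
    Frame R'' M'' σ ρ :=
  ⟨fun a ha => (h'.idx a fun x => ha (h₃ x)).trans (h.idx a fun x => ha (h₁ x)),
    fun a ha => (h'.num a fun x => ha (h₄ x)).trans (h.num a fun x => ha (h₂ x))⟩

theorem Store.Frame.mono {R M R' M' : Set ℕ} {σ τ : Store K} (h : Frame R M σ τ)
    (h₁ : R ⊆ R') (h₂ : M ⊆ M') : Frame R' M' σ τ :=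
  h.trans (Frame.refl R' M' τ) h₁ h₂ subset_rfl subset_rfl

theorem Store.ext_of {σ τ : Store K} (h : ∀ a, σ.idx a = τ.idx a) (h' : σ.num = τ.num) :
    σ = τ := by
  cases σ
  cases τ
  simp only [Store.mk.injEq]
  exact ⟨funext h, h'⟩


/-- A position in `Fin n` of a largest value among `f 0, …, f (n - 1)`. -/
def argmaxNat [LinearOrder K] (f : ℕ → K) : ℕ → ℕ
  | 0 => 0
  | n + 1 => if f (argmaxNat f n) < f n then n else argmaxNat f n

theorem argmaxNat_lt [LinearOrder K] (f : ℕ → K) {n : ℕ} (hn : 0 < n) : argmaxNat f n < n := by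
  induction n with
  | zero => omega
  | succ n ih =>
    rw [argmaxNat]
    split
    · omega
    · rcases Nat.eq_zero_or_pos n with rfl | h
      · simp [argmaxNat]
      · have := ih h
        omega

theorem argmaxNat_le [LinearOrder K] (f : ℕ → K) (n : ℕ) : argmaxNat f n ≤ n := by
  rcases Nat.eq_zero_or_pos n with rfl | h
  · simp [argmaxNat]
  · exact (argmaxNat_lt f h).le

theorem le_argmaxNat [LinearOrder K] (f : ℕ → K) {n k : ℕ} (hk : k < n) : f k ≤ f (argmaxNat f n) := by
  induction n with
  | zero => omega
  | succ n ih =>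
    rw [argmaxNat]
    rcases Nat.lt_succ_iff_lt_or_eq.1 hk with h | rfl
    · split
      · next hlt => exact (ih h).trans hlt.le
      · exact ih h
    · split
      · exact le_rfl
      · next hlt => exact not_lt.1 hlt

variable [Field K] [LinearOrder K]

theorem Store.Frame.putIdx {R M : Set ℕ} {σ τ : Store K} (h : Frame R M σ τ) {a n : ℕ}
    (ha : a ∈ R) : Frame R M σ (τ.putIdx a n) := by
  refine ⟨fun b hb => ?_, h.num⟩
  rw [Store.putIdx_idx, if_neg (fun e : b = a => hb (e ▸ ha)), h.idx b hb]

theorem Store.Frame.put {R M : Set ℕ} {σ τ : Store K} (h : Frame R M σ τ) {u : Ref} {x : K}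
    (hu : u.arr ∈ M) : Frame R M σ (τ.put u x) := by
  refine ⟨h.idx, fun A hA => ?_⟩
  rw [Store.put_num_of_ne _ _ _ (fun e : A = u.arr => hA (e ▸ hu)), h.num A hA]

/-- The value of a reference that is read within a loop with the counter `a`. -/
theorem Store.Frame.get {R M : Set ℕ} {σ τ : Store K} (h : Frame R M σ τ) {a l : ℕ}
    (hl : τ.idx a = l) {u : Ref} (hM : u.arr ∉ M) (hr : u.row = a ∨ u.row ∉ R)
    (hc : u.col = a ∨ u.col ∉ R) : τ.get u = (σ.putIdx a l).get u := by
  have key : ∀ b, (b = a ∨ b ∉ R) → τ.idx b = (σ.putIdx a l).idx b := by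
    intro b hb
    rw [Store.putIdx_idx]
    split
    · next e => rw [e, hl]
    · next e => exact h.idx b (hb.resolve_left e)
  rw [Store.get, Store.get, h.num _ hM, key _ hr, key _ hc, Store.putIdx_num]

/-- Put into the register `d` the position of a largest value; the value at the position in the
register `d` is at `u`, and the value at the position in the register `6` is at `v`. -/
def argmaxProg (d b : ℕ) (u v : Ref) : Prog :=
  .seq (.setIdx d 0) (.for 6 b (.cond (.numLt u v) (.addIdx d 6 2) .skip))

/-- The number of steps of `argmaxProg`. -/
def argmaxSteps (n : ℕ) : ℕ := 1 + loopSteps n 2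

variable {E : Budget K} {σ : Store K} {Post : Store K → Prop}

/-- The store after `l` rounds is known exactly: register `d` holds the best position among the
first `l`. The strict comparison makes the choice a function of the data alone, so repeated calls
agree. -/
theorem Budget.Runs.argmax {d b m : ℕ} {u v : Ref} {f : ℕ → K} (hd6 : d ≠ 6) (hd2 : d ≠ 2)
    (hd3 : d ≠ 3) (hdb : d ≠ b) (hb6 : b ≠ 6) (h2 : σ.idx 2 = 0) (h3 : σ.idx 3 = 1)
    (hb : σ.idx b = m) (hm : m ≤ E.maxIdx)
    (hu : ∀ k l, ((σ.putIdx d k).putIdx 6 l).get u = f k)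
    (hv : ∀ k l, ((σ.putIdx d k).putIdx 6 l).get v = f l)
    (hP : Post ((σ.putIdx d (argmaxNat f m)).putIdx 6 m)) :
    E.Runs (argmaxProg d b u v) (argmaxSteps E.maxIdx) Post σ := by
  refine .seq (.setIdx (Nat.zero_le _) (.for
    (fun l τ => τ = (σ.putIdx d (argmaxNat f l)).putIdx 6 l) hm rfl ?_ ?_ ?_))
  · rintro l τ - rfl
    simp [hb, hb6, hdb.symm]
  · rintro l τ hl rfl
    refine .cond (fun ht => .addIdx ?_ ?_) fun ht => .skip ?_
    · have e2 : ((σ.putIdx d (argmaxNat f l)).putIdx 6 l).idx 2 = 0 := by simp [hd2.symm, h2]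
      rw [e2, Store.putIdx_idx, if_pos rfl]
      omega
    · rw [Test.Holds, hu, hv] at ht
      refine ⟨by simp [hd6.symm], by simp [hd3.symm, h3], Store.ext_of (fun a => ?_) rfl⟩
      simp only [Store.putIdx_idx, argmaxNat, if_pos ht, if_true, hd2.symm, if_false, h2]
      split_ifs <;> simp_all
    · rw [Test.Holds, hu, hv] at ht
      refine ⟨by simp, by simp [hd3.symm, h3], Store.ext_of (fun a => ?_) rfl⟩
      simp only [Store.putIdx_idx, argmaxNat, if_neg ht]
      split_ifs <;> simp_all
  · rintro τ rfl
    exact hP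

/-- Put the inner product of two vectors into the accumulator; their entries at the position in
the register `6` are at `u` and `v`. -/
def dotProg (b : ℕ) (u v : Ref) : Prog :=
  .seq (.const ⟨7, 2, 2⟩ 0) (.for 6 b
    (.seq (.arith .mul ⟨8, 2, 2⟩ u v) (.arith .add ⟨7, 2, 2⟩ ⟨7, 2, 2⟩ ⟨8, 2, 2⟩)))

/-- The number of steps of `dotProg`. -/
def dotSteps (n : ℕ) : ℕ := 1 + loopSteps n (1 + 1)

theorem Budget.Runs.dot {b m : ℕ} {u v : Ref} {f g : ℕ → K} (hb6 : b ≠ 6)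
    (hu7 : u.arr ≠ 7) (hu8 : u.arr ≠ 8) (hv7 : v.arr ≠ 7) (hv8 : v.arr ≠ 8)
    (h2 : σ.idx 2 = 0) (h3 : σ.idx 3 = 1) (hb : σ.idx b = m) (hm : m ≤ E.maxIdx)
    (hu : ∀ l < m, (σ.putIdx 6 l).get u = f l) (hv : ∀ l < m, (σ.putIdx 6 l).get v = g l)
    (hs : ∀ l < m, E.small (f l * g l))
    (hs' : ∀ l ≤ m, E.small (∑ k ∈ Finset.range l, f k * g k))
    (hP : ∀ τ, Store.Frame {6} {7, 8} σ τ →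
      τ.num 7 0 0 = ∑ k ∈ Finset.range m, f k * g k → Post τ) :
    E.Runs (dotProg b u v) (dotSteps E.maxIdx) Post σ := by
  have hf0 := Store.Frame.refl {6} {7, 8} σ
  have hs0 : E.small ((0 : ℤ) : K) := by simpa using hs' 0 (Nat.zero_le _)
  refine .seq (.const hs0 (.for (fun l τ => τ.idx 6 = l ∧ Store.Frame {6} {7, 8} σ τ ∧
    τ.num 7 0 0 = ∑ k ∈ Finset.range l, f k * g k) hm ⟨by simp, (hf0.put (by simp)).putIdx
      (by simp), by simp [Store.put_num, h2]⟩ ?_ ?_ ?_))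
  · rintro l τ - ⟨h6, hf, -⟩
    exact ⟨h6, by rw [hf.idx b (by simp [hb6]), hb]⟩
  · rintro l τ hl ⟨h6, hf, hacc⟩
    have e2 : τ.idx 2 = 0 := by rw [hf.idx 2 (by simp), h2]
    have e3 : τ.idx 3 = 1 := by rw [hf.idx 3 (by simp), h3]
    have eu : τ.get u = f l := by
      rw [hf.get h6 (by simp [hu7, hu8]) (by simp; tauto) (by simp; tauto), hu l hl]
    have ev : τ.get v = g l := by
      rw [hf.get h6 (by simp [hv7, hv8]) (by simp; tauto) (by simp; tauto), hv l hl]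
    refine .seq (.arith trivial ?_ ?_)
    · simpa only [ArithOp.val, eu, ev] using hs l hl
    · have e : (τ.put ⟨8, 2, 2⟩ (ArithOp.mul.val (τ.get u) (τ.get v))).get ⟨7, 2, 2⟩ +
          (τ.put ⟨8, 2, 2⟩ (ArithOp.mul.val (τ.get u) (τ.get v))).get ⟨8, 2, 2⟩ =
          ∑ k ∈ Finset.range (l + 1), f k * g k := by
        simp [Store.get, Store.put_num, e2, hacc, Finset.sum_range_succ, ArithOp.val]
        rw [← eu, ← ev]
        rfl
      refine .arith trivial ?_ ⟨?_, ?_, ?_, ?_, ?_⟩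
      · rw [ArithOp.val, e]
        exact hs' _ hl
      · simpa using h6
      · simpa using e3
      · simp
      · exact ((hf.put (by simp)).put (by simp)).putIdx (by simp)
      · rw [Store.putIdx_num, Store.put_num, ArithOp.val, e]
        simp [e2]
  · rintro τ ⟨-, hf, hacc⟩
    exact hP τ hf hacc

/-- Divide the column of the array `A` in the register `c` by the accumulator. -/
def scaleProg (b A c : ℕ) : Prog :=
  .for 6 b (.arith .div ⟨A, 6, c⟩ ⟨A, 6, c⟩ ⟨7, 2, 2⟩)

/-- The number of steps of `scaleProg`. -/
def scaleSteps (n : ℕ) : ℕ := loopSteps n 1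

theorem Budget.Runs.scale {b m A c : ℕ} (hb6 : b ≠ 6) (hA7 : A ≠ 7) (hc6 : c ≠ 6)
    (h2 : σ.idx 2 = 0) (h3 : σ.idx 3 = 1) (hb : σ.idx b = m) (hm : m ≤ E.maxIdx)
    (h0 : σ.num 7 0 0 ≠ 0)
    (hs : ∀ l < m, E.small (σ.num A l (σ.idx c) / σ.num 7 0 0))
    (hP : ∀ τ, Store.Frame {6} {A} σ τ → (∀ l k, τ.num A l k =
      if l < m ∧ k = σ.idx c then σ.num A l k / σ.num 7 0 0 else σ.num A l k) → Post τ) :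
    E.Runs (scaleProg b A c) (scaleSteps E.maxIdx) Post σ := by
  refine .for (fun n τ => τ.idx 6 = n ∧ Store.Frame {6} {A} σ τ ∧ ∀ l k, τ.num A l k =
      if l < n ∧ k = σ.idx c then σ.num A l k / σ.num 7 0 0 else σ.num A l k) hm
    ⟨by simp, (Store.Frame.refl _ _ σ).putIdx (by simp), by simp⟩ ?_ ?_ ?_
  · rintro n τ - ⟨h6, hf, -⟩
    exact ⟨h6, by rw [hf.idx b (by simp [hb6]), hb]⟩
  · rintro n τ hn ⟨h6, hf, hA⟩
    have e2 : τ.idx 2 = 0 := by rw [hf.idx 2 (by simp), h2]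
    have e3 : τ.idx 3 = 1 := by rw [hf.idx 3 (by simp), h3]
    have ec : τ.idx c = σ.idx c := hf.idx c (by simp [hc6])
    have e7 : τ.get ⟨7, 2, 2⟩ = σ.num 7 0 0 := by
      simp only [Store.get, e2]
      rw [hf.num 7 (by simp [hA7.symm])]
    have eA : τ.get ⟨A, 6, c⟩ = σ.num A n (σ.idx c) := by
      simp only [Store.get, h6, ec, hA]
      simp
    refine .arith (by simpa only [ArithOp.Legal, e7] using h0) ?_ ⟨by simpa using h6,
      by simpa using e3, by simp, (hf.put (by simp)).putIdx (by simp), fun l k => ?_⟩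
    · simpa only [ArithOp.val, e7, eA] using hs n hn
    · simp only [ArithOp.val, e7, eA, Store.putIdx_num, Store.put_num, h6, ec, hA, true_and]
      by_cases h : k = σ.idx c
      · subst h
        by_cases hl : l = n
        · subst hl; simp
        · have : l < n + 1 ↔ l < n := by omega
          simp [hl, this]
      · simp [h]
  · rintro τ ⟨-, hf, hA⟩
    exact hP τ hf hA

/-- Subtract the product of the accumulator and the column of the array `B` in the register `i`
from the column of the array `A` in the register `c`. -/
def axpyProg (b A c B i : ℕ) : Prog :=
  .for 6 b (.seq (.arith .mul ⟨8, 2, 2⟩ ⟨7, 2, 2⟩ ⟨B, 6, i⟩)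
    (.arith .sub ⟨A, 6, c⟩ ⟨A, 6, c⟩ ⟨8, 2, 2⟩))

/-- The number of steps of `axpyProg`. -/
def axpySteps (n : ℕ) : ℕ := loopSteps n (1 + 1)

/-- Within a single array the two columns must differ, so that the column being read is not
overwritten. -/
theorem Budget.Runs.axpy {b m A c B i : ℕ} (hb6 : b ≠ 6) (hA7 : A ≠ 7) (hA8 : A ≠ 8)
    (hB8 : B ≠ 8) (hc6 : c ≠ 6) (hi6 : i ≠ 6) (h2 : σ.idx 2 = 0) (h3 : σ.idx 3 = 1)
    (hb : σ.idx b = m) (hm : m ≤ E.maxIdx) (hAB : A = B → σ.idx c ≠ σ.idx i)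
    (hs : ∀ l < m, E.small (σ.num 7 0 0 * σ.num B l (σ.idx i)))
    (hs' : ∀ l < m, E.small (σ.num A l (σ.idx c) - σ.num 7 0 0 * σ.num B l (σ.idx i)))
    (hP : ∀ τ, Store.Frame {6} {8, A} σ τ → (∀ l k, τ.num A l k =
      if l < m ∧ k = σ.idx c then σ.num A l k - σ.num 7 0 0 * σ.num B l (σ.idx i)
      else σ.num A l k) → Post τ) :
    E.Runs (axpyProg b A c B i) (axpySteps E.maxIdx) Post σ := by
  refine .for (fun n τ => τ.idx 6 = n ∧ Store.Frame {6} {8, A} σ τ ∧ ∀ l k, τ.num A l k =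
      if l < n ∧ k = σ.idx c then σ.num A l k - σ.num 7 0 0 * σ.num B l (σ.idx i)
      else σ.num A l k) hm
    ⟨by simp, (Store.Frame.refl _ _ σ).putIdx (by simp), by simp⟩ ?_ ?_ ?_
  · rintro n τ - ⟨h6, hf, -⟩
    exact ⟨h6, by rw [hf.idx b (by simp [hb6]), hb]⟩
  · rintro n τ hn ⟨h6, hf, hA⟩
    have e2 : τ.idx 2 = 0 := by rw [hf.idx 2 (by simp), h2]
    have e3 : τ.idx 3 = 1 := by rw [hf.idx 3 (by simp), h3]
    have ec : τ.idx c = σ.idx c := hf.idx c (by simp [hc6])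
    have ei : τ.idx i = σ.idx i := hf.idx i (by simp [hi6])
    have e7 : τ.get ⟨7, 2, 2⟩ = σ.num 7 0 0 := by
      simp only [Store.get, e2]
      rw [hf.num 7 (by simp [hA7.symm])]
    have eB : τ.get ⟨B, 6, i⟩ = σ.num B n (σ.idx i) := by
      simp only [Store.get, h6, ei]
      by_cases h : A = B
      · rw [← h, hA, if_neg fun h' => hAB h h'.2.symm]
      · rw [hf.num B (by simp [hB8, Ne.symm h])]
    refine .seq (.arith trivial ?_ ?_)
    · simpa only [ArithOp.val, e7, eB] using hs n hn
    rw [ArithOp.val, e7, eB]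
    set x := σ.num 7 0 0 * σ.num B n (σ.idx i) with hx
    have eA' : (τ.put ⟨8, 2, 2⟩ x).get ⟨A, 6, c⟩ = σ.num A n (σ.idx c) := by
      simp only [Store.get, Store.put_idx]
      rw [Store.put_num_of_ne _ _ _ hA8, h6, ec, hA]
      simp
    have e8 : (τ.put ⟨8, 2, 2⟩ x).get ⟨8, 2, 2⟩ = x := by
      simp [Store.get, Store.put_num]
    refine .arith trivial ?_ ⟨by simpa using h6, by simpa using e3, by simp,
      ((hf.put (by simp)).put (by simp)).putIdx (by simp), fun l k => ?_⟩
    · simpa only [ArithOp.val, eA', e8] using hs' n hn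
    · rw [ArithOp.val, eA', e8, Store.putIdx_num, Store.put_num,
        Store.put_num_of_ne _ _ _ hA8, hA]
      simp only [Store.put_idx, h6, ec, true_and]
      by_cases h : k = σ.idx c
      · subst h
        by_cases hl : l = n
        · subst hl; simp [hx]
        · have : l < n + 1 ↔ l < n := by omega
          simp [hl, this]
      · simp [h]
  · rintro τ ⟨-, hf, hA⟩
    exact hP τ hf hA

/-- Put ones on the diagonal of the array `A`. -/
def diagProg (b A : ℕ) : Prog := .for 8 b (.const ⟨A, 8, 8⟩ 1)

/-- The number of steps of `diagProg`. -/
def diagSteps (n : ℕ) : ℕ := loopSteps n 1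

theorem Budget.Runs.diag {b m A : ℕ} (hb8 : b ≠ 8) (h3 : σ.idx 3 = 1) (hb : σ.idx b = m)
    (hm : m ≤ E.maxIdx) (hs : E.small 1)
    (hP : ∀ τ, Store.Frame {8} {A} σ τ → (∀ l k, τ.num A l k =
      if l < m ∧ l = k then 1 else σ.num A l k) → Post τ) :
    E.Runs (diagProg b A) (diagSteps E.maxIdx) Post σ := by
  refine .for (fun n τ => τ.idx 8 = n ∧ Store.Frame {8} {A} σ τ ∧ ∀ l k, τ.num A l k =
      if l < n ∧ l = k then 1 else σ.num A l k) hm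
    ⟨by simp, (Store.Frame.refl _ _ σ).putIdx (by simp), by simp⟩ ?_ ?_ ?_
  · rintro n τ - ⟨h8, hf, -⟩
    exact ⟨h8, by rw [hf.idx b (by simp [hb8]), hb]⟩
  · rintro n τ hn ⟨h8, hf, hA⟩
    have e3 : τ.idx 3 = 1 := by rw [hf.idx 3 (by simp), h3]
    refine .const (by simpa using hs) ⟨by simpa using h8, by simpa using e3, by simp,
      (hf.put (by simp)).putIdx (by simp), fun l k => ?_⟩
    simp only [Store.putIdx_num, Store.put_num, h8, hA, true_and, Int.cast_one]
    by_cases h : l = k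
    · subst h
      by_cases hl : l = n
      · subst hl; simp
      · have : l < n + 1 ↔ l < n := by omega
        simp [hl, this]
    · have : ¬ (l = n ∧ k = n) := by omega
      simp [h, this]
  · rintro τ ⟨-, hf, hA⟩
    exact hP τ hf hA

end Subprograms

end FieldRAM

/-! ### Updating the inverse, and normalizing -/

namespace FieldRAM

section Update

variable {K : Type} [Field K] [LinearOrder K] {sz : K → ℕ}

/-- The budget with numbers of at most `N` bits and indices up to `n`. -/
def SizeScale.budget {K : Type} [Field K] {sz : K → ℕ} (Z : SizeScale K sz) (N n : ℕ) :
    Budget K where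
  sz := sz
  small := Z.Small N
  bits := 2 * N + 3
  maxIdx := n
  sz_le := fun _ h => Z.sz_le h

/-- Update the inverse matrix in the array `B`, and the solution in the array `X` of a system
with this matrix, when the row in the register `i` is replaced by the vector whose entry at the
position in the register `6` is at `v`, and the right-hand side of this row by `1`. -/
def updateProg (b i B X : ℕ) (v : Ref) : Prog :=
  .seq (dotProg b v ⟨B, 6, i⟩) (.seq (scaleProg b B i) (.seq
    (.for 7 b (.cond (.idxEq 7 i) .skip (.seq (dotProg b v ⟨B, 6, 7⟩) (axpyProg b B 7 B i))))
    (.seq (dotProg b v ⟨X, 6, 2⟩) (.seq (.const ⟨8, 2, 2⟩ 1)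
      (.seq (.arith .sub ⟨7, 2, 2⟩ ⟨7, 2, 2⟩ ⟨8, 2, 2⟩) (axpyProg b X 2 B i))))))

/-- The number of steps of `updateProg`. -/
def updateSteps (n : ℕ) : ℕ :=
  dotSteps n + (scaleSteps n + (loopSteps n (dotSteps n + axpySteps n + 1) +
    (dotSteps n + (1 + (1 + axpySteps n)))))

/-- The number of bits of all numbers occurring in `updateProg`, if the data have `N` bits. -/
def updateBits (n N : ℕ) : ℕ := 2 * N + 2 * (n * (N + N + 1)) + 3

theorem Store.Frame.get_putIdx {R M : Set ℕ} {σ τ : Store K} (h : Store.Frame R M σ τ) {a l : ℕ}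
    (ha : a ∈ R) {u : Ref} (hM : u.arr ∉ M) (hr : u.row = a ∨ u.row ∉ R)
    (hc : u.col = a ∨ u.col ∉ R) : (τ.putIdx a l).get u = (σ.putIdx a l).get u :=
  (h.putIdx ha).get (by simp) hM hr hc

/-- Correctness of the column operations in place. With `N₁ = n * (2 * N₀ + 1)` bits for a dot
product, a coefficient times a scaled entry, subtracted from an old entry, needs at most `2 * N₀ + 2
* N₁ + 2` bits, which `updateBits` covers. -/
theorem Budget.Runs.update (Z : SizeScale K sz) {N N₀ n m b i B X q : ℕ} {v : Ref} {a : ℕ → K}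
    {σ : Store K} {Post : Store K → Prop}
    (hb6 : b ≠ 6) (hb7 : b ≠ 7) (hi6 : i ≠ 6) (hi7 : i ≠ 7) (hB7 : B ≠ 7) (hB8 : B ≠ 8)
    (hX7 : X ≠ 7) (hX8 : X ≠ 8) (hBX : B ≠ X) (hv7 : v.arr ≠ 7) (hv8 : v.arr ≠ 8)
    (hvB : v.arr ≠ B) (hvX : v.arr ≠ X) (hr7 : v.row ≠ 7) (hc7 : v.col ≠ 7)
    (h2 : σ.idx 2 = 0) (h3 : σ.idx 3 = 1) (hb : σ.idx b = m) (hm : m ≤ n) (hi : σ.idx i = q)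
    (hq : q < m) (ha : ∀ l < m, (σ.putIdx 6 l).get v = a l)
    (sa : ∀ l < m, Z.Small N₀ (a l)) (sB : ∀ l < m, ∀ k < m, Z.Small N₀ (σ.num B l k))
    (sX : ∀ l < m, Z.Small N₀ (σ.num X l 0)) (hN : updateBits n N₀ ≤ N)
    (hp : ∑ l ∈ Finset.range m, a l * σ.num B l q ≠ 0)
    (hP : ∀ τ, Store.Frame {6, 7} {7, 8, B, X} σ τ →
      (∀ l < m, ∀ k < m, τ.num B l k =
        if k = q then σ.num B l q / ∑ l ∈ Finset.range m, a l * σ.num B l q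
        else σ.num B l k - (∑ l ∈ Finset.range m, a l * σ.num B l k) *
          (σ.num B l q / ∑ l ∈ Finset.range m, a l * σ.num B l q)) →
      (∀ l < m, τ.num X l 0 = σ.num X l 0 - (∑ l ∈ Finset.range m, a l * σ.num X l 0 - 1) *
          (σ.num B l q / ∑ l ∈ Finset.range m, a l * σ.num B l q)) → Post τ) :
    (Z.budget N n).Runs (updateProg b i B X v) (updateSteps n) Post σ := by
  have smul : ∀ f : ℕ → K, (∀ l < m, Z.Small N₀ (f l)) → ∀ l < m,
      Z.Small (N₀ + N₀) (a l * f l) := fun f hf l hl => Z.mul (sa l hl) (hf l hl)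
  have sdot : ∀ f : ℕ → K, (∀ l < m, Z.Small N₀ (f l)) → ∀ l ≤ m,
      Z.Small (n * (N₀ + N₀ + 1)) (∑ k ∈ Finset.range l, a k * f k) := fun f hf l hl =>
    Z.sum_range (fun k hk => smul f hf k (by omega)) (hl.trans hm)
  unfold updateBits at hN
  set N₁ := n * (N₀ + N₀ + 1) with hN₁
  have smulN : ∀ f : ℕ → K, (∀ l < m, Z.Small N₀ (f l)) → ∀ l < m,
      Z.Small N (a l * f l) := fun f hf l hl => by
    refine Z.mono ?_ (smul f hf l hl)
    omega
  have sdotN : ∀ f : ℕ → K, (∀ l < m, Z.Small N₀ (f l)) → ∀ l ≤ m,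
      Z.Small N (∑ k ∈ Finset.range l, a k * f k) := fun f hf l hl => by
    refine Z.mono ?_ (sdot f hf l hl)
    omega
  set p := ∑ l ∈ Finset.range m, a l * σ.num B l q with hpdef
  have sp : Z.Small N₁ p := sdot _ (fun l hl => sB l hl q hq) m le_rfl
  have sdiv : ∀ l < m, Z.Small (N₀ + N₁) (σ.num B l q / p) := fun l hl => Z.div (sB l hl q hq) sp
  have hv := fun (τ : Store K) (hf : Store.Frame {6, 7} {7, 8, B, X} σ τ) (l : ℕ) (hl : l < m) =>
    show (τ.putIdx 6 l).get v = a l by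
      rw [hf.get_putIdx (by simp) (by simp [hv7, hv8, hvB, hvX]) (by simp; tauto) (by simp; tauto),
        ha l hl]
  refine .seq (.dot hb6 hv7 hv8 hB7 hB8 h2 h3 hb hm ha (g := fun l => σ.num B l q)
    (fun l hl => by simp [Store.get, hi6, hi]) (smulN _ fun l hl => sB l hl q hq)
    (sdotN _ fun l hl => sB l hl q hq) fun τ hf₁ hacc => ?_)
  have eB : τ.num B = σ.num B := hf₁.num B (by simp [hB7, hB8])
  have hf₁' : Store.Frame {6, 7} {7, 8, B, X} σ τ := hf₁.mono (by simp) (by grind)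
  have e2 : ∀ τ, Store.Frame {6, 7} {7, 8, B, X} σ τ → τ.idx 2 = 0 := fun τ h => by
    rw [h.idx 2 (by simp), h2]
  have e3 : ∀ τ, Store.Frame {6, 7} {7, 8, B, X} σ τ → τ.idx 3 = 1 := fun τ h => by
    rw [h.idx 3 (by simp), h3]
  have eb : ∀ τ, Store.Frame {6, 7} {7, 8, B, X} σ τ → τ.idx b = m := fun τ h => by
    rw [h.idx b (by simp [hb6, hb7]), hb]
  have ei : ∀ τ, Store.Frame {6, 7} {7, 8, B, X} σ τ → τ.idx i = q := fun τ h => by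
    rw [h.idx i (by simp [hi6, hi7]), hi]
  refine .seq (.scale hb6 hB7 hi6 (e2 τ hf₁') (e3 τ hf₁') (eb τ hf₁') hm (by rw [hacc]; exact hp)
    (fun l hl => ?_) fun τ₂ hf₂ hB₂ => ?_)
  · rw [hacc, eB, ei τ hf₁']
    exact Z.mono (by omega) (sdiv l hl)
  rw [eB, ei τ hf₁', hacc] at hB₂
  have hf₂' : Store.Frame {6, 7} {7, 8, B, X} σ τ₂ :=
    hf₁'.trans hf₂ subset_rfl subset_rfl (by simp) (by simp)
  have eX₂ : τ₂.num X = σ.num X := by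
    rw [hf₂.num X (by simp [hBX.symm]), hf₁.num X (by simp [hX7, hX8])]
  -- Column `q` is already scaled, the other columns before `c` are updated, and the later ones are
  -- still original. Hence each dot product uses the old column, as the formula requires.
  refine .seq (.for (fun c ρ => ρ.idx 7 = c ∧ Store.Frame {6, 7} {7, 8, B, X} σ ρ ∧
    ρ.num X = σ.num X ∧ ∀ l < m, ∀ k < m, ρ.num B l k = if k = q then σ.num B l q / p
      else if k < c then σ.num B l k - (∑ l ∈ Finset.range m, a l * σ.num B l k) *
          (σ.num B l q / p) else σ.num B l k) hm ⟨by simp, hf₂'.putIdx (by simp), eX₂, ?_⟩ ?_ ?_ ?_)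
  · intro l hl k hk
    rw [Store.putIdx_num, hB₂]
    by_cases h : k = q <;> simp [h, hl, hpdef]
  · rintro c ρ - ⟨h7, hf, -, -⟩
    exact ⟨h7, eb ρ hf⟩
  · rintro c ρ hc ⟨h7, hf, hX, hB⟩
    refine .cond (fun ht => ?_) fun ht => ?_
    · have hcq : c = q := by
        rw [Test.Holds, h7, ei ρ hf] at ht
        exact ht
      -- Both branches of a conditional must share a step bound, so the trivial one is padded.
      refine (Budget.Runs.skip (Post := fun τ => τ = ρ) rfl).mono ?_ ?_
      · unfold dotSteps
        omega
      rintro τ rfl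
      refine ⟨h7, e3 _ hf, by simp, hf.putIdx (by simp), hX, fun l hl k hk => ?_⟩
      rw [Store.putIdx_num, hB l hl k hk]
      by_cases h : k = q
      · simp [h]
      · have : k < c + 1 ↔ k < c := by omega
        simp [h, this]
    · have hcq : c ≠ q := by
        rw [Test.Holds, h7, ei ρ hf] at ht
        exact ht
      have hBc : ∀ l < m, ρ.num B l c = σ.num B l c := fun l hl => by
        rw [hB l hl c hc, if_neg hcq, if_neg (lt_irrefl c)]
      refine .seq (.dot hb6 hv7 hv8 hB7 hB8 (e2 ρ hf) (e3 ρ hf) (eb ρ hf) hm (hv ρ hf)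
        (g := fun l => σ.num B l c) (fun l hl => ?_) (smulN _ fun l hl => sB l hl c hc)
        (sdotN _ fun l hl => sB l hl c hc) fun ρ₂ hg₂ hacc₂ => ?_)
      · simp [Store.get, h7, hBc l hl]
      have hg₂' : Store.Frame {6, 7} {7, 8, B, X} σ ρ₂ :=
        hf.trans hg₂ subset_rfl subset_rfl (by simp) (by grind)
      have eB₂ : ρ₂.num B = ρ.num B := hg₂.num B (by simp [hB7, hB8])
      have e7 : ρ₂.idx 7 = c := by rw [hg₂.idx 7 (by simp), h7]
      have hBq : ∀ l < m, ρ.num B l q = σ.num B l q / p := fun l hl => by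
        rw [hB l hl q hq, if_pos rfl]
      have sw := sdot _ (fun l hl => sB l hl c hc) m le_rfl
      refine .axpy hb6 hB7 hB8 hB8 (by simp) hi6 (e2 _ hg₂') (e3 _ hg₂') (eb _ hg₂') hm
        (fun _ => by rwa [e7, ei _ hg₂']) (fun l hl => ?_) (fun l hl => ?_)
        fun ρ₃ hg₃ hB₃ => ?_
      · rw [hacc₂, eB₂, ei _ hg₂', hBq l hl]
        exact Z.mono (by omega) (Z.mul sw (sdiv l hl))
      · rw [hacc₂, eB₂, ei _ hg₂', hBq l hl, e7, hBc l hl]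
        exact Z.mono (by omega) (Z.sub (sB l hl c hc) (Z.mul sw (sdiv l hl)))
      · have hg₃' : Store.Frame {6, 7} {7, 8, B, X} σ ρ₃ :=
          hg₂'.trans hg₃ subset_rfl subset_rfl (by simp) (by grind)
        refine ⟨by rw [hg₃.idx 7 (by simp), e7], e3 _ hg₃', by simp, hg₃'.putIdx (by simp), ?_,
          fun l hl k hk => ?_⟩
        · rw [Store.putIdx_num, hg₃.num X (by simp [hX8, hBX.symm]),
            hg₂.num X (by simp [hX7, hX8]), hX]
        · rw [Store.putIdx_num, hB₃, hacc₂, eB₂, ei _ hg₂', hBq l hl, e7]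
          by_cases h : k = c
          · subst h
            simp [hl, hcq, hBc l hl]
          · have : k < c + 1 ↔ k < c := by omega
            simp [h, hB l hl k hk, this]
  rintro ρ ⟨-, hf, hX, hB⟩
  refine .seq (.dot hb6 hv7 hv8 hX7 hX8 (e2 ρ hf) (e3 ρ hf) (eb ρ hf) hm (hv ρ hf)
    (g := fun l => σ.num X l 0) (fun l hl => ?_) (smulN _ sX) (sdotN _ sX) fun ρ₂ hg₂ hacc₂ => ?_)
  · simp [Store.get, e2 ρ hf, hX]
  have hg₂' : Store.Frame {6, 7} {7, 8, B, X} σ ρ₂ :=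
    hf.trans hg₂ subset_rfl subset_rfl (by simp) (by grind)
  have sw := Z.sub (sdot _ sX m le_rfl) Z.one
  refine .seq (.const ?_ (.seq ?_))
  · rw [Int.cast_one]
    exact Z.mono (Nat.zero_le _) Z.one
  have e2' := e2 _ hg₂'
  have e7 : (ρ₂.put ⟨8, 2, 2⟩ ((1 : ℤ) : K)).get ⟨7, 2, 2⟩ =
      ∑ l ∈ Finset.range m, a l * σ.num X l 0 := by
    simp [Store.get, Store.put_num, e2', hacc₂]
  have e8 : (ρ₂.put ⟨8, 2, 2⟩ ((1 : ℤ) : K)).get ⟨8, 2, 2⟩ = 1 := by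
    simp [Store.get, Store.put_num, e2']
  refine .arith trivial ?_ ?_
  · rw [ArithOp.val, e7, e8]
    exact Z.mono (by omega) sw
  rw [ArithOp.val, e7, e8]
  set w := ∑ l ∈ Finset.range m, a l * σ.num X l 0 - 1 with hw
  set ω := (ρ₂.put ⟨8, 2, 2⟩ ((1 : ℤ) : K)).put ⟨7, 2, 2⟩ w with hω
  have hf₄ : Store.Frame {6, 7} {7, 8, B, X} σ ω := (hg₂'.put (by simp)).put (by simp)
  have ew : ω.num 7 0 0 = w := by simp [hω, Store.put_num, e2']
  have hωA : ∀ A, A ≠ 7 → A ≠ 8 → ω.num A = ρ.num A := fun A h h' => by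
    rw [hω, Store.put_num_of_ne _ _ _ h, Store.put_num_of_ne _ _ _ h', hg₂.num A (by simp [h, h'])]
  have hBq : ∀ l < m, ω.num B l (ω.idx i) = σ.num B l q / p := fun l hl => by
    rw [ei _ hf₄, hωA B hB7 hB8, hB l hl q hq, if_pos rfl]
  have eX : ω.num X = σ.num X := by rw [hωA X hX7 hX8, hX]
  refine .axpy hb6 hX7 hX8 hB8 (by simp) hi6 (e2 _ hf₄) (e3 _ hf₄) (eb _ hf₄) hm
    (fun h => absurd h hBX.symm) (fun l hl => ?_) (fun l hl => ?_) fun τ' hg hX' =>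
      hP τ' (hf₄.trans hg subset_rfl subset_rfl (by simp) (by grind)) (fun l hl k hk => ?_)
      fun l hl => ?_
  · rw [ew, hBq l hl]
    exact Z.mono (by omega) (Z.mul sw (sdiv l hl))
  · rw [ew, hBq l hl, eX, e2 _ hf₄]
    exact Z.mono (by omega) (Z.sub (sX l hl) (Z.mul sw (sdiv l hl)))
  · rw [hg.num B (by simp [hB8, hBX]), hωA B hB7 hB8, hB l hl k hk, if_pos hk]
  · rw [hX', ew, e2 _ hf₄, if_pos ⟨hl, rfl⟩, hBq l hl, eX]

/-- Divide the vector in the array `X` by the sum of its entries. -/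
def normalizeProg (b X : ℕ) : Prog :=
  .seq (.const ⟨9, 2, 2⟩ 1) (.seq (dotProg b ⟨X, 6, 2⟩ ⟨9, 2, 2⟩) (scaleProg b X 2))

/-- The number of steps of `normalizeProg`. -/
def normalizeSteps (n : ℕ) : ℕ := 1 + (dotSteps n + scaleSteps n)

theorem Budget.Runs.normalize (Z : SizeScale K sz) {N N₀ n m b X : ℕ} {σ : Store K}
    {Post : Store K → Prop} (hb6 : b ≠ 6) (hX7 : X ≠ 7) (hX8 : X ≠ 8) (hX9 : X ≠ 9)
    (h2 : σ.idx 2 = 0) (h3 : σ.idx 3 = 1) (hb : σ.idx b = m) (hm : m ≤ n)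
    (sX : ∀ l < m, Z.Small N₀ (σ.num X l 0)) (hN : updateBits n N₀ ≤ N)
    (hp : ∑ l ∈ Finset.range m, σ.num X l 0 ≠ 0)
    (hP : ∀ τ, Store.Frame {6} {7, 8, 9, X} σ τ → (∀ l < m, τ.num X l 0 =
        σ.num X l 0 / ∑ l ∈ Finset.range m, σ.num X l 0) → Post τ) :
    (Z.budget N n).Runs (normalizeProg b X) (normalizeSteps n) Post σ := by
  have hsum : ∀ l ≤ m, Z.Small (n * (N₀ + 1)) (∑ k ∈ Finset.range l, σ.num X k 0) :=
    fun l hl => Z.sum_range (fun k hk => sX k (by omega)) (hl.trans hm)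
  have hle : n * (N₀ + 1) ≤ n * (N₀ + N₀ + 1) := Nat.mul_le_mul_left _ (by omega)
  unfold updateBits at hN
  refine .seq (.const ?_ (.seq ?_))
  · rw [Int.cast_one]
    exact Z.mono (Nat.zero_le _) Z.one
  set ρ := σ.put ⟨9, 2, 2⟩ ((1 : ℤ) : K) with hρ
  have hf : Store.Frame {6} {7, 8, 9, X} σ ρ := (Store.Frame.refl _ _ σ).put (by simp)
  have eX : ρ.num X = σ.num X := Store.put_num_of_ne _ _ _ hX9
  have e9 : ρ.num 9 0 0 = 1 := by simp [hρ, Store.put_num, h2]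
  refine .dot hb6 hX7 hX8 (by simp) (by simp) h2 h3 hb hm (f := fun l => σ.num X l 0)
    (g := fun _ => 1) (fun l hl => ?_) (fun l hl => ?_) (fun l hl => ?_) (fun l hl => ?_)
    fun τ hg hacc => ?_
  · rw [Store.get, Store.putIdx_num, eX]
    simp [hρ, h2]
  · rw [Store.get, Store.putIdx_num]
    simpa [hρ, h2] using e9
  · rw [mul_one]
    exact Z.mono (by omega) (sX l hl)
  · simp only [mul_one]
    exact Z.mono (by omega) (hsum l hl)
  simp only [mul_one] at hacc
  have hg' : Store.Frame {6} {7, 8, 9, X} σ τ :=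
    hf.trans hg subset_rfl subset_rfl subset_rfl (by grind)
  have e2 : τ.idx 2 = 0 := by rw [hg'.idx 2 (by simp), h2]
  have eX' : τ.num X = σ.num X := by rw [hg.num X (by simp [hX7, hX8]), eX]
  refine .scale hb6 hX7 (by simp) e2 (by rw [hg'.idx 3 (by simp), h3])
    (by rw [hg'.idx b (by simp [hb6]), hb]) hm (by rwa [hacc]) (fun l hl => ?_)
    fun τ' hg'' hX' => hP τ' (hg'.trans hg'' subset_rfl subset_rfl subset_rfl (by simp))
      fun l hl => ?_
  · rw [hacc, eX', e2]
    exact Z.mono (by omega) (Z.div (sX l hl) (hsum m le_rfl))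
  · rw [hX', e2, if_pos ⟨hl, rfl⟩, hacc, eX']

end Update

end FieldRAM

/-! ### Cycles of a self-map of a finite set -/

/-- By pigeonhole two of the first `r + 1` iterates coincide, so the orbit has become periodic by
time `r`. -/
theorem exists_pos_isPeriodicPt_iterate {r : ℕ} (f : Fin r → Fin r) (i : Fin r) :
    ∃ d, 0 < d ∧ d ≤ r ∧ Function.IsPeriodicPt f d (f^[r] i) := by
  obtain ⟨a, b, hne, hab⟩ := Fintype.exists_ne_map_eq_of_card_lt
    (fun t : Fin (r + 1) => f^[t] i) (by simp)
  have key : ∀ a b : Fin (r + 1), a < b → f^[a] i = f^[b] i →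
      ∃ d, 0 < d ∧ d ≤ r ∧ Function.IsPeriodicPt f d (f^[r] i) := by
    intro a b hlt hab
    have hlt' : (a : ℕ) < b := hlt
    have hb := b.isLt
    refine ⟨b - a, by omega, by omega, ?_⟩
    have h1 : Function.IsPeriodicPt f (b - a) (f^[a] i) := by
      rw [Function.IsPeriodicPt, Function.IsFixedPt, ← Function.iterate_add_apply,
        Nat.sub_add_cancel hlt'.le, hab]
    have h2 : f^[r] i = f^[r - a] (f^[a] i) := by
      rw [← Function.iterate_add_apply, Nat.sub_add_cancel (by omega)]
    rw [h2]
    exact h1.apply_iterate _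
  rcases lt_or_gt_of_ne hne with h | h
  · exact key a b h hab
  · exact key b a h hab.symm

/-- The first `k` points of the orbit of `i`. -/
def orbitSegment {r : ℕ} (f : Fin r → Fin r) (i : Fin r) (k : ℕ) : Finset (Fin r) :=
  (Finset.range k).image fun t => f^[t] i

theorem orbitSegment_succ {r : ℕ} (f : Fin r → Fin r) (i : Fin r) (k : ℕ) :
    orbitSegment f i (k + 1) = insert (f^[k] i) (orbitSegment f i k) := by
  rw [orbitSegment, Finset.range_add_one, Finset.image_insert, orbitSegment]

theorem orbitSegment_mono {r : ℕ} (f : Fin r → Fin r) (i : Fin r) {k l : ℕ} (h : k ≤ l) :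
    orbitSegment f i k ⊆ orbitSegment f i l :=
  Finset.image_subset_image (Finset.range_mono h)

/-- The period is at most `r`, so the segment of length `r` is the entire cycle, possibly traversed
more than once. -/
theorem injOn_orbitSegment_and_image_eq {r : ℕ} (f : Fin r → Fin r) (i : Fin r) :
    Set.InjOn f (orbitSegment f (f^[r] i) r) ∧
      (orbitSegment f (f^[r] i) r).image f = orbitSegment f (f^[r] i) r := by
  obtain ⟨d, hd, hdr, hper⟩ := exists_pos_isPeriodicPt_iterate f i
  set p := f^[r] i
  have hmem : ∀ t, f^[t] p ∈ orbitSegment f p r := fun t => by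
    rw [← hper.iterate_mod_apply]
    exact Finset.mem_image_of_mem _ (Finset.mem_range.2 ((Nat.mod_lt _ hd).trans_le hdr))
  -- On the cycle, `f^[d - 1]` inverts `f`.
  have hfix : ∀ x ∈ orbitSegment f p r, f^[d - 1] (f x) = x := fun x hx => by
    obtain ⟨t, -, rfl⟩ := Finset.mem_image.1 hx
    rw [← Function.iterate_succ_apply, Nat.succ_eq_add_one, Nat.sub_add_cancel hd]
    exact hper.apply_iterate t
  refine ⟨fun x hx y hy hxy => ?_, Finset.Subset.antisymm ?_ ?_⟩
  · rw [← hfix x hx, hxy, hfix y hy]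
  · intro x hx
    obtain ⟨y, hy, rfl⟩ := Finset.mem_image.1 hx
    obtain ⟨t, -, rfl⟩ := Finset.mem_image.1 hy
    rw [← Function.iterate_succ_apply' f]
    exact hmem _
  · intro x hx
    rw [← hfix x hx, ← Function.iterate_succ_apply, Function.iterate_succ_apply']
    refine Finset.mem_image_of_mem _ ?_
    obtain ⟨t, -, rfl⟩ := Finset.mem_image.1 hx
    rw [← Function.iterate_add_apply]
    exact hmem _

/-! ### Best replies, the walk to the cycle, and the linear systems -/

namespace FieldRAM

section Program

variable {K : Type} [Field K] [LinearOrder K] {sz : K → ℕ}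

/-- A bound for the bits of the entries of the inverse of the matrix of the system, and of its
solution. -/
def solutionBits (n M : ℕ) : ℕ := M + invBits n M + n * (invBits n M + 1)

theorem invBits_mono {m n N : ℕ} (h : m ≤ n) : invBits m N ≤ invBits n N := by
  unfold invBits
  gcongr

/-- The matrix has entries of `Q`, zeros and ones, so the bound depends only on the input and not on
how the inverse was computed. -/
theorem SizeScale.indiffMatrix_inv (Z : SizeScale K sz) {k m n M : ℕ}
    {Q : Matrix (Fin k) (Fin m) K} (hQ : ∀ i j, Z.Small M (Q i j)) (hk : k ≤ n)
    (β : Fin k → Fin m) (S : Finset (Fin k)) (hdet : (indiffMatrix Q β S).det ≠ 0) (i j : Fin k) :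
    Z.Small (invBits n M) ((indiffMatrix Q β S)⁻¹ i j) := by
  refine Z.mono (invBits_mono hk) (Z.inv (fun i j => ?_) hdet i j)
  rw [indiffMatrix, Matrix.of_apply, Matrix.one_apply]
  split_ifs
  · exact hQ _ _
  · exact Z.mono (Nat.zero_le _) Z.one
  · exact Z.mono (Nat.zero_le _) Z.zero

theorem SizeScale.indiffMatrix_solution (Z : SizeScale K sz) {k m n M : ℕ}
    {Q : Matrix (Fin k) (Fin m) K} (hQ : ∀ i j, Z.Small M (Q i j)) (hk : k ≤ n)
    (β : Fin k → Fin m) (S : Finset (Fin k)) (hdet : (indiffMatrix Q β S).det ≠ 0) (i : Fin k) :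
    Z.Small (n * (invBits n M + 1)) ((indiffMatrix Q β S)⁻¹.mulVec (indiffVec S 1) i) := by
  rw [Matrix.mulVec, dotProduct, Finset.sum_fin_eq_sum_range]
  refine Z.sum_range (fun l hl => ?_) hk
  rw [dif_pos hl, indiffVec]
  have := Z.indiffMatrix_inv hQ hk β S hdet i ⟨l, hl⟩
  split_ifs
  · simpa using this
  · simpa using Z.mono (Nat.zero_le _) Z.zero

/-- The arrays `B` and `X` contain the inverse of the matrix of the system and its solution. -/
structure Store.Solves {k m : ℕ} (Q : Matrix (Fin k) (Fin m) K) (β : Fin k → Fin m)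
    (S : Finset (Fin k)) (B X : ℕ) (σ : Store K) : Prop where
  inv : ∀ i j : Fin k, σ.num B i j = (indiffMatrix Q β S)⁻¹ i j
  sol : ∀ i : Fin k, σ.num X i 0 = (indiffMatrix Q β S)⁻¹.mulVec (indiffVec S 1) i

theorem Store.Solves.congr {k m : ℕ} {Q : Matrix (Fin k) (Fin m) K} {β : Fin k → Fin m}
    {S : Finset (Fin k)} {B X : ℕ} {σ τ : Store K} (h : σ.Solves Q β S B X)
    (hB : τ.num B = σ.num B) (hX : τ.num X = σ.num X) : τ.Solves Q β S B X :=
  ⟨fun i j => by rw [hB, h.inv], fun i => by rw [hX, h.sol]⟩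

/-- The sizes before an update are bounded through what the arrays mean, not through the history of
the computation; this is what prevents repeated growth. The row `q` may already be in `S`, in which
case the system is unchanged. -/
theorem Budget.Runs.update_solves (Z : SizeScale K sz) {N M n m k b i B X : ℕ} {v : Ref}
    {Q : Matrix (Fin k) (Fin m) K} {β : Fin k → Fin m} {S : Finset (Fin k)} {q : Fin k}
    {σ : Store K} {Post : Store K → Prop}
    (hb6 : b ≠ 6) (hb7 : b ≠ 7) (hi6 : i ≠ 6) (hi7 : i ≠ 7) (hB7 : B ≠ 7) (hB8 : B ≠ 8)
    (hX7 : X ≠ 7) (hX8 : X ≠ 8) (hBX : B ≠ X) (hv7 : v.arr ≠ 7) (hv8 : v.arr ≠ 8)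
    (hvB : v.arr ≠ B) (hvX : v.arr ≠ X) (hr7 : v.row ≠ 7) (hc7 : v.col ≠ 7)
    (h2 : σ.idx 2 = 0) (h3 : σ.idx 3 = 1) (hb : σ.idx b = k) (hk : k ≤ n) (hi : σ.idx i = q)
    (ha : ∀ l : Fin k, (σ.putIdx 6 l).get v = Q l (β q)) (hQ : ∀ i j, Z.Small M (Q i j))
    (hσ : σ.Solves Q β S B X) (hdet : (indiffMatrix Q β S).det ≠ 0)
    (hdet' : (indiffMatrix Q β (insert q S)).det ≠ 0) (hN : updateBits n (solutionBits n M) ≤ N)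
    (hP : ∀ τ, Store.Frame {6, 7} {7, 8, B, X} σ τ → τ.Solves Q β (insert q S) B X → Post τ) :
    (Z.budget N n).Runs (updateProg b i B X v) (updateSteps n) Post σ := by
  set A := indiffMatrix Q β S with hA
  have hins := indiffMatrix_insert Q β S q
  have hsum : ∀ j : Fin k, ∑ l ∈ Finset.range k, (σ.putIdx 6 l).get v * σ.num B l j =
      ∑ l, Q l (β q) * A⁻¹ l j := fun j => by
    rw [Finset.sum_range]
    exact Finset.sum_congr rfl fun l _ => by rw [ha, hσ.inv]
  have hsum' : ∑ l ∈ Finset.range k, (σ.putIdx 6 l).get v * σ.num X l 0 =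
      ∑ l, Q l (β q) * A⁻¹.mulVec (indiffVec S 1) l := by
    rw [Finset.sum_range]
    exact Finset.sum_congr rfl fun l _ => by rw [ha, hσ.sol]
  rw [hins] at hdet'
  refine .update Z (N₀ := solutionBits n M) (q := q) (a := fun l => (σ.putIdx 6 l).get v)
    hb6 hb7 hi6 hi7 hB7 hB8 hX7 hX8 hBX hv7 hv8 hvB hvX hr7 hc7 h2 h3 hb hk hi q.isLt
    (fun _ _ => rfl) (fun l hl => ?_) (fun l hl j hj => ?_) (fun l hl => ?_) hN ?_
    fun τ hf hB hX => hP τ hf ⟨fun l j => ?_, fun l => ?_⟩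
  · have := ha ⟨l, hl⟩
    rw [show (σ.putIdx 6 l).get v = _ from this]
    exact Z.mono (by unfold solutionBits; omega) (hQ _ _)
  · rw [show σ.num B l j = _ from hσ.inv ⟨l, hl⟩ ⟨j, hj⟩]
    exact Z.mono (by unfold solutionBits; omega) (Z.indiffMatrix_inv hQ hk β S hdet _ _)
  · rw [show σ.num X l 0 = _ from hσ.sol ⟨l, hl⟩]
    exact Z.mono (by unfold solutionBits; omega) (Z.indiffMatrix_solution hQ hk β S hdet _)
  · rw [hsum]
    exact updateRow_pivot_ne_zero hdet hdet'
  · rw [hB l l.isLt j j.isLt, hins, updateRow_inv_apply hdet hdet', hsum, hsum, hσ.inv, hσ.inv]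
    simp only [Fin.val_inj, hA]
  · rw [hX l l.isLt, hins, indiffVec_insert, updateRow_inv_mulVec hdet hdet', hsum, hsum', hσ.inv,
      hσ.sol]

variable {r s : ℕ} (P Q : Matrix (Fin r) (Fin s) K)

/-- The input is still present, and the constants are in place. -/
structure Store.Ready (σ : Store K) : Prop where
  rows : σ.idx 0 = r
  cols : σ.idx 1 = s
  zero : σ.idx 2 = 0
  one : σ.idx 3 = 1
  fst : ∀ (i : Fin r) (j : Fin s), σ.num 0 i j = P i j
  snd : ∀ (i : Fin r) (j : Fin s), σ.num 1 i j = Q i j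

variable {P Q}

theorem Store.Ready.frame {σ τ : Store K} (h : σ.Ready P Q) {R M : Set ℕ}
    (hf : Store.Frame R M σ τ) (h0 : 0 ∉ R) (h1 : 1 ∉ R) (h2 : 2 ∉ R) (h3 : 3 ∉ R) (g0 : 0 ∉ M)
    (g1 : 1 ∉ M) : τ.Ready P Q where
  rows := by rw [hf.idx 0 h0, h.rows]
  cols := by rw [hf.idx 1 h1, h.cols]
  zero := by rw [hf.idx 2 h2, h.zero]
  one := by rw [hf.idx 3 h3, h.one]
  fst := fun i j => by rw [hf.num 0 g0, h.fst]
  snd := fun i j => by rw [hf.num 1 g1, h.snd]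

/-- A position of a largest entry of the vector `f`. -/
def argmaxFin {n : ℕ} (hn : 0 < n) (f : Fin n → K) : Fin n :=
  ⟨argmaxNat (fun k => if h : k < n then f ⟨k, h⟩ else 0) n, argmaxNat_lt _ hn⟩

theorem le_argmaxFin {n : ℕ} (hn : 0 < n) (f : Fin n → K) (k : Fin n) :
    f k ≤ f (argmaxFin hn f) := by
  have := le_argmaxNat (fun k => if h : k < n then f ⟨k, h⟩ else 0) k.isLt
  rwa [dif_pos k.isLt, dif_pos (argmaxNat_lt _ hn)] at this

/-- Only the first `n` values are compared, so an array and a vector padded with zeros give the same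
position. -/
theorem argmaxNat_congr {f g : ℕ → K} {n : ℕ} (h : ∀ k < n, f k = g k) :
    argmaxNat f n = argmaxNat g n := by
  induction n with
  | zero => rfl
  | succ n ih =>
    have ih := ih fun k hk => h k (by omega)
    have hlt : argmaxNat g n < n + 1 := Nat.lt_succ_of_le (argmaxNat_le g n)
    rw [argmaxNat, argmaxNat, ih, h n (by omega), h _ hlt]

theorem argmaxNat_eq_argmaxFin {n : ℕ} (hn : 0 < n) (f : Fin n → K) {g : ℕ → K}
    (h : ∀ k : Fin n, g k = f k) : argmaxNat g n = argmaxFin hn f := by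
  refine argmaxNat_congr fun k hk => ?_
  rw [dif_pos hk]
  exact h ⟨k, hk⟩

/-- The best column against the row in the register `4` goes to the register `5`. -/
def chooseCol : Prog := argmaxProg 5 1 ⟨1, 4, 5⟩ ⟨1, 4, 6⟩

/-- The best row against the column in the register `5` goes to the register `4`. -/
def chooseRow : Prog := argmaxProg 4 0 ⟨0, 4, 5⟩ ⟨0, 6, 5⟩

variable {E : Budget K} {σ : Store K} {Post : Store K → Prop}

theorem Budget.Runs.chooseCol (hs : 0 < s) (hσ : σ.Ready P Q) (hE : s ≤ E.maxIdx) {i : Fin r}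
    (hi : σ.idx 4 = i) (hP : ∀ τ, Store.Frame {5, 6} ∅ σ τ →
      τ.idx 5 = argmaxFin hs (Q i) → Post τ) :
    E.Runs chooseCol (argmaxSteps E.maxIdx) Post σ := by
  refine .argmax (f := fun j => σ.num 1 i j) (by simp) (by simp) (by simp) (by simp) (by simp)
    hσ.zero hσ.one hσ.cols hE (fun k l => by simp [Store.get, hi])
    (fun k l => by simp [Store.get, hi])
    (hP _ (((Store.Frame.refl _ _ σ).putIdx (by simp)).putIdx (by simp)) ?_)
  simp [argmaxNat_eq_argmaxFin hs (Q i) (hσ.snd i)]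

theorem Budget.Runs.chooseRow (hr : 0 < r) (hσ : σ.Ready P Q) (hE : r ≤ E.maxIdx) {j : Fin s}
    (hj : σ.idx 5 = j) (hP : ∀ τ, Store.Frame {4, 6} ∅ σ τ →
      τ.idx 4 = argmaxFin hr (fun i => P i j) → Post τ) :
    E.Runs chooseRow (argmaxSteps E.maxIdx) Post σ := by
  refine .argmax (f := fun i => σ.num 0 i j) (by simp) (by simp) (by simp) (by simp) (by simp)
    hσ.zero hσ.one hσ.rows hE (fun k l => by simp [Store.get, hj])
    (fun k l => by simp [Store.get, hj])
    (hP _ (((Store.Frame.refl _ _ σ).putIdx (by simp)).putIdx (by simp)) ?_)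
  simp [argmaxNat_eq_argmaxFin hr (fun i => P i j) (g := fun i => σ.num 0 i j) fun i => hσ.fst i j]

/-- Alternate best choices until the row in the register `4` is periodic. -/
def walkProg : Prog := .for 8 0 (.seq chooseCol chooseRow)

/-- The number of steps of `walkProg`. -/
def walkSteps (n : ℕ) : ℕ := loopSteps n (argmaxSteps n + argmaxSteps n)

/-- The best row against the best column against the row `i`. -/
def bestRow (P Q : Matrix (Fin r) (Fin s) K) (hr : 0 < r) (hs : 0 < s) (i : Fin r) : Fin r :=
  argmaxFin hr fun i' => P i' (argmaxFin hs (Q i))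

theorem Budget.Runs.walk (hr : 0 < r) (hs : 0 < s) (hσ : σ.Ready P Q) (hE : r ≤ E.maxIdx)
    (hE' : s ≤ E.maxIdx) {i : Fin r} (hi : σ.idx 4 = i)
    (hP : ∀ τ, Store.Frame {4, 5, 6, 8} ∅ σ τ →
      τ.idx 4 = (bestRow P Q hr hs)^[r] i → Post τ) :
    E.Runs walkProg (walkSteps E.maxIdx) Post σ := by
  refine .for (fun t τ => τ.idx 8 = t ∧ Store.Frame {4, 5, 6, 8} ∅ σ τ ∧
    τ.idx 4 = (bestRow P Q hr hs)^[t] i) hE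
    ⟨by simp, (Store.Frame.refl _ _ σ).putIdx (by simp), by simpa using hi⟩ ?_ ?_ ?_
  · rintro t τ - ⟨h8, hf, -⟩
    exact ⟨h8, by rw [hf.idx 0 (by simp), hσ.rows]⟩
  · rintro t τ ht ⟨h8, hf, h4⟩
    have hτ : τ.Ready P Q := hσ.frame hf (by simp) (by simp) (by simp) (by simp) (by simp) (by simp)
    refine .seq (.chooseCol hs hτ hE' h4 fun τ₁ hf₁ h5 => .chooseRow hr (hτ.frame hf₁ (by simp)
      (by simp) (by simp) (by simp) (by simp) (by simp)) hE h5 fun τ₂ hf₂ h4' => ?_)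
    have hg : Store.Frame {4, 5, 6, 8} ∅ σ τ₂ :=
      (hf.trans hf₁ subset_rfl subset_rfl (by grind) subset_rfl).trans hf₂ subset_rfl subset_rfl
        (by grind) subset_rfl
    refine ⟨?_, ?_, by simp, hg.putIdx (by simp), ?_⟩
    · rw [hf₂.idx 8 (by simp), hf₁.idx 8 (by simp), h8]
    · rw [hg.idx 3 (by simp), hσ.one]
    · rw [Function.iterate_succ_apply']
      simpa [bestRow] using h4'
  · rintro τ ⟨-, hf, h4⟩
    exact hP τ hf h4

/-- Extend the systems of both players along the cycle that starts in the register `4`. -/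
def solveProg : Prog :=
  .for 8 0 (.seq chooseCol (.seq (updateProg 0 4 4 2 ⟨1, 6, 5⟩)
    (.seq chooseRow (updateProg 1 5 5 3 ⟨0, 4, 6⟩))))

/-- The number of steps of `solveProg`. -/
def solveSteps (n : ℕ) : ℕ :=
  loopSteps n (argmaxSteps n + (updateSteps n + (argmaxSteps n + updateSteps n)))

variable [IsStrictOrderedRing K]

/-- After `t` rounds the supports are the first `t` points of the orbit and their best columns.
Injectivity passes to these subsets, so both systems stay nonsingular throughout. -/
theorem Budget.Runs.solve (Z : SizeScale K sz) {N M n : ℕ} (hr : 2 ≤ r) (hs : 2 ≤ s)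
    (hP0 : ∀ i j, 0 ≤ P i j) (hQ0 : ∀ i j, 0 ≤ Q i j) {α : Fin s → Fin r} {β : Fin r → Fin s}
    (hα : α = fun j => argmaxFin (Nat.zero_lt_of_lt hr) fun i => P i j)
    (hβ : β = fun i => argmaxFin (Nat.zero_lt_of_lt hs) (Q i))
    (hαd : IsDominantChoice P.transpose α) (hβd : IsDominantChoice Q β)
    (sP : ∀ i j, Z.Small M (P i j)) (sQ : ∀ i j, Z.Small M (Q i j))
    (hN : updateBits n (solutionBits n M) ≤ N) (hrn : r ≤ n) (hsn : s ≤ n)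
    (hσ : σ.Ready P Q) {i : Fin r} (hi : σ.idx 4 = i)
    (hinj : Set.InjOn (fun i => α (β i)) (orbitSegment (fun i => α (β i)) i r))
    (hB : σ.Solves Q β ∅ 4 2) (hC : σ.Solves P.transpose α ∅ 5 3)
    (hP : ∀ τ, Store.Frame {4, 5, 6, 7, 8} {2, 3, 4, 5, 7, 8} σ τ →
      τ.Solves Q β (orbitSegment (fun i => α (β i)) i r) 4 2 →
      τ.Solves P.transpose α ((orbitSegment (fun i => α (β i)) i r).image β) 5 3 → Post τ) :
    (Z.budget N n).Runs solveProg (solveSteps n) Post σ := by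
  set f : Fin r → Fin r := fun i => α (β i) with hf
  -- Injectivity of `α ∘ β` on the orbit gives that of `β` there, and that of `α` on the image under
  -- `β`.
  have hinjβ : ∀ t ≤ r, Set.InjOn β (orbitSegment f i t) := fun t ht x hx y hy hxy =>
    hinj (orbitSegment_mono f i ht hx) (orbitSegment_mono f i ht hy) (congrArg α hxy)
  have hinjα : ∀ t ≤ r, Set.InjOn α ((orbitSegment f i t).image β) := fun t ht x hx y hy hxy => by
    obtain ⟨x', hx', rfl⟩ := Finset.mem_image.1 (Finset.mem_coe.1 hx)
    obtain ⟨y', hy', rfl⟩ := Finset.mem_image.1 (Finset.mem_coe.1 hy)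
    rw [hinj (orbitSegment_mono f i ht hx') (orbitSegment_mono f i ht hy') hxy]
  have hdetβ : ∀ t ≤ r, (indiffMatrix Q β (orbitSegment f i t)).det ≠ 0 := fun t ht =>
    det_indiffMatrix_ne_zero hQ0 hs hβd (hinjβ t ht)
  have hdetα : ∀ t ≤ r,
      (indiffMatrix P.transpose α ((orbitSegment f i t).image β)).det ≠ 0 := fun t ht =>
    det_indiffMatrix_ne_zero (fun i j => hP0 j i) hr hαd (hinjα t ht)
  refine .for (fun t τ => τ.idx 8 = t ∧ Store.Frame {4, 5, 6, 7, 8} {2, 3, 4, 5, 7, 8} σ τ ∧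
    τ.idx 4 = f^[t] i ∧ τ.Solves Q β (orbitSegment f i t) 4 2 ∧
    τ.Solves P.transpose α ((orbitSegment f i t).image β) 5 3) hrn
    ⟨by simp, (Store.Frame.refl _ _ σ).putIdx (by simp), by simpa using hi,
      hB.congr rfl rfl, hC.congr rfl rfl⟩ ?_ ?_ ?_
  · rintro t τ - ⟨h8, hf, -⟩
    exact ⟨h8, by rw [hf.idx 0 (by simp), hσ.rows]⟩
  · rintro t τ ht ⟨h8, hfr, h4, hB, hC⟩
    have hτ : τ.Ready P Q :=
      hσ.frame hfr (by simp) (by simp) (by simp) (by simp) (by simp) (by simp)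
    refine .seq (.chooseCol (by omega) hτ hsn h4 fun τ₁ hf₁ h5 => ?_)
    have hτ₁ := hτ.frame hf₁ (by simp) (by simp) (by simp) (by simp) (by simp) (by simp)
    have h4₁ : τ₁.idx 4 = f^[t] i := by rw [hf₁.idx 4 (by simp), h4]
    have h5₁ : τ₁.idx 5 = β (f^[t] i) := by rw [h5, hβ]
    refine .seq (.update_solves Z (q := f^[t] i) (by simp) (by simp) (by simp) (by simp) (by simp)
      (by simp) (by simp) (by simp) (by simp) (by simp) (by simp) (by simp) (by simp) (by simp)
      (by simp) hτ₁.zero hτ₁.one hτ₁.rows hrn h4₁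
      (fun l => by simpa [Store.get, h5₁] using hτ₁.snd l _) sQ
      (hB.congr (hf₁.num 4 (by simp)) (hf₁.num 2 (by simp))) (hdetβ t ht.le)
      (by rw [← orbitSegment_succ]; exact hdetβ _ ht) hN fun τ₂ hf₂ hB₂ => ?_)
    have hτ₂ := hτ₁.frame hf₂ (by simp) (by simp) (by simp) (by simp) (by simp) (by simp)
    have h5₂ : τ₂.idx 5 = β (f^[t] i) := by rw [hf₂.idx 5 (by simp), h5₁]
    refine .seq (.chooseRow (by omega) hτ₂ hrn h5₂ fun τ₃ hf₃ h4₃ => ?_)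
    have hτ₃ := hτ₂.frame hf₃ (by simp) (by simp) (by simp) (by simp) (by simp) (by simp)
    have h5₃ : τ₃.idx 5 = β (f^[t] i) := by rw [hf₃.idx 5 (by simp), h5₂]
    have h4₃' : τ₃.idx 4 = α (β (f^[t] i)) := by rw [h4₃, hα]
    have e5 : τ₃.num 5 = τ.num 5 := by
      rw [hf₃.num 5 (by simp), hf₂.num 5 (by simp), hf₁.num 5 (by simp)]
    have e3 : τ₃.num 3 = τ.num 3 := by
      rw [hf₃.num 3 (by simp), hf₂.num 3 (by simp), hf₁.num 3 (by simp)]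
    have hT : (orbitSegment f i (t + 1)).image β =
        insert (β (f^[t] i)) ((orbitSegment f i t).image β) := by
      rw [orbitSegment_succ, Finset.image_insert]
    refine .update_solves Z (q := β (f^[t] i)) (by simp) (by simp) (by simp) (by simp) (by simp)
      (by simp) (by simp) (by simp) (by simp) (by simp) (by simp) (by simp) (by simp) (by simp)
      (by simp) hτ₃.zero hτ₃.one hτ₃.cols hsn h5₃
      (fun l => by simpa [Store.get, h4₃'] using hτ₃.fst _ l) (fun i j => sP j i)
      (hC.congr e5 e3) (hdetα t ht.le)
      (by rw [← hT]; exact hdetα _ ht) hN fun τ₄ hf₄ hC₄ => ?_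
    have hg : Store.Frame {4, 5, 6, 7, 8} {2, 3, 4, 5, 7, 8} σ τ₄ :=
      (((hfr.trans hf₁ subset_rfl subset_rfl (by grind) (by simp)).trans hf₂ subset_rfl subset_rfl
        (by grind) (by grind)).trans hf₃ subset_rfl subset_rfl (by grind) (by simp)).trans hf₄
        subset_rfl subset_rfl (by grind) (by grind)
    refine ⟨?_, ?_, by simp, hg.putIdx (by simp), ?_, ?_, ?_⟩
    · rw [hf₄.idx 8 (by simp), hf₃.idx 8 (by simp), hf₂.idx 8 (by simp), hf₁.idx 8 (by simp), h8]
    · rw [hg.idx 3 (by simp), hσ.one]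
    · rw [Store.putIdx_idx, if_neg (by simp), hf₄.idx 4 (by simp), h4₃',
        Function.iterate_succ_apply']
    · rw [orbitSegment_succ]
      refine hB₂.congr ?_ ?_
      · rw [Store.putIdx_num, hf₄.num 4 (by simp), hf₃.num 4 (by simp)]
      · rw [Store.putIdx_num, hf₄.num 2 (by simp), hf₃.num 2 (by simp)]
    · rw [hT]
      exact hC₄.congr rfl rfl
  · rintro τ ⟨-, hf, -, hB, hC⟩
    exact hP τ hf hB hC

end Program

end FieldRAM

/-! ### The complete program and its correctness -/

namespace FieldRAM

section Program

variable {K : Type} [Field K] [LinearOrder K] {sz : K → ℕ}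

/-- Find a pure equilibrium, if one of the players has a single action. -/
def pureProg : Prog :=
  .seq chooseCol (.seq chooseRow (.seq (.const ⟨2, 4, 2⟩ 1) (.const ⟨3, 5, 2⟩ 1)))

/-- Find an equilibrium, if both players have at least two actions. -/
def mixedProg : Prog :=
  .seq (diagProg 0 4) (.seq (diagProg 1 5) (.seq walkProg (.seq solveProg
    (.seq (normalizeProg 0 2) (normalizeProg 1 3)))))

/-- The program that finds an equilibrium. -/
def nashProg : Prog :=
  .seq (.setIdx 3 1) (.cond (.idxEq 0 3) pureProg (.cond (.idxEq 1 3) pureProg mixedProg))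

/-- The number of steps of `pureProg`. -/
def pureSteps (n : ℕ) : ℕ := argmaxSteps n + (argmaxSteps n + (1 + 1))

/-- The number of steps of `mixedProg`. -/
def mixedSteps (n : ℕ) : ℕ :=
  diagSteps n + (diagSteps n + (walkSteps n + (solveSteps n +
    (normalizeSteps n + normalizeSteps n))))

/-- The number of steps of `nashProg`. -/
def nashSteps (n : ℕ) : ℕ := 1 + (pureSteps n + mixedSteps n + 1 + 1)

/-- The number of bits of all numbers occurring in `nashProg`, if the payoffs have `M` bits. -/
def nashBits (n M : ℕ) : ℕ := updateBits n (solutionBits n M)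

/-- The running time of `nashProg`. -/
def nashTime (n M : ℕ) : ℕ := nashSteps n * (1 + 6 * n + 3 * (2 * nashBits n M + 3))

/-- For the empty support the matrix is the identity and the right-hand side is zero, so the initial
arrays need only a diagonal of ones. -/
theorem Store.Solves.empty {k m : ℕ} {Q : Matrix (Fin k) (Fin m) K} {β : Fin k → Fin m} {B X : ℕ}
    {σ : Store K} (hB : ∀ i j : Fin k, σ.num B i j = if i = j then 1 else 0)
    (hX : ∀ i : Fin k, σ.num X i 0 = 0) : σ.Solves Q β ∅ B X := by
  have h1 : indiffMatrix Q β ∅ = 1 := by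
    ext i j
    simp [indiffMatrix]
  have h2 : indiffVec (∅ : Finset (Fin k)) (1 : K) = 0 := by
    funext i
    simp [indiffVec]
  refine ⟨fun i j => ?_, fun i => ?_⟩
  · rw [hB, h1, inv_one, Matrix.one_apply]
  · rw [hX, h2, Matrix.mulVec_zero, Pi.zero_apply]

variable {r s : ℕ} {P Q : Matrix (Fin r) (Fin s) K} {E : Budget K} {σ : Store K}
  [IsStrictOrderedRing K] {ι : K →+* ℝ}

/-- The chosen row is a best reply to the chosen column. Conversely, the column was chosen against
the only row if `r = 1`, and is the only column if `s = 1`. -/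
theorem Budget.Runs.pure (hι : StrictMono ι) (hr : 0 < r) (hs : 0 < s) (hrs : r = 1 ∨ s = 1)
    (hσ : σ.Ready P Q) (hrE : r ≤ E.maxIdx) (hsE : s ≤ E.maxIdx) (h4 : σ.idx 4 = 0)
    (h1 : E.small 1) (h02 : ∀ i j, σ.num 2 i j = 0) (h03 : ∀ i j, σ.num 3 i j = 0) :
    E.Runs pureProg (pureSteps E.maxIdx) (fun τ => IsNashEquilibrium (P.map ι) (Q.map ι)
      (fun i => ι (outputVec 2 r τ i)) (fun j => ι (outputVec 3 s τ j))) σ := by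
  have h1' : E.small ((1 : ℤ) : K) := by rwa [Int.cast_one]
  refine .seq (.chooseCol (i := ⟨0, hr⟩) hs hσ hsE h4 fun τ₁ hf₁ h5 => .seq (.chooseRow hr
    (hσ.frame hf₁ (by simp) (by simp) (by simp) (by simp) (by simp) (by simp)) hrE h5
    fun τ₂ hf₂ h4' => .seq (.const h1' (.const h1' ?_))))
  set j := argmaxFin hs (Q ⟨0, hr⟩) with hj
  set i := argmaxFin hr (fun i => P i j) with hi
  have e2 : τ₂.idx 2 = 0 := by rw [hf₂.idx 2 (by simp), hf₁.idx 2 (by simp), hσ.zero]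
  have e5 : τ₂.idx 5 = j := by rw [hf₂.idx 5 (by simp), h5]
  have g2 : ∀ k l, τ₂.num 2 k l = 0 := fun k l => by
    rw [hf₂.num 2 (by simp), hf₁.num 2 (by simp), h02]
  have g3 : ∀ k l, τ₂.num 3 k l = 0 := fun k l => by
    rw [hf₂.num 3 (by simp), hf₁.num 3 (by simp), h03]
  convert isNashEquilibrium_pure ι hι (P := P) (Q := Q) (i := i) (j := j)
    (fun k => le_argmaxFin hr (fun i => P i j) k) (fun k => ?_) using 3 with k k
  · simp [outputVec, Store.put_num, e2, h4', g2, Fin.val_inj]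
  · simp [outputVec, Store.put_num, e2, e5, g3, Fin.val_inj]
  · rcases hrs with rfl | rfl
    · rw [Subsingleton.elim i ⟨0, hr⟩]
      exact le_argmaxFin hs _ k
    · rw [Subsingleton.elim k j]

theorem Budget.Runs.mixed (Z : SizeScale K sz) (hι : StrictMono ι) {M n : ℕ} (hr : 2 ≤ r)
    (hs : 2 ≤ s) (hP0 : ∀ i j, 0 ≤ P i j) (hQ0 : ∀ i j, 0 ≤ Q i j)
    (hP : HasDominantColumnEntries (P.map ι)) (hQ : HasDominantColumnEntries (Q.map ι).transpose)
    (sP : ∀ i j, Z.Small M (P i j)) (sQ : ∀ i j, Z.Small M (Q i j)) (hrn : r ≤ n) (hsn : s ≤ n)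
    (hσ : σ.Ready P Q) (h4 : σ.idx 4 = 0)
    (h0 : ∀ A, 2 ≤ A → ∀ i j, σ.num A i j = 0) :
    (Z.budget (nashBits n M) n).Runs mixedProg (mixedSteps n)
      (fun τ => IsNashEquilibrium (P.map ι) (Q.map ι)
        (fun i => ι (outputVec 2 r τ i)) (fun j => ι (outputVec 3 s τ j))) σ := by
  have hr0 : 0 < r := by omega
  have hs0 : 0 < s := by omega
  have s1 : (Z.budget (nashBits n M) n).small 1 := Z.mono (Nat.zero_le _) Z.one
  set α : Fin s → Fin r := fun j => argmaxFin hr0 fun i => P i j with hα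
  set β : Fin r → Fin s := fun i => argmaxFin hs0 (Q i) with hβ
  have hP0' : ∀ i j, 0 ≤ P.transpose i j := fun i j => hP0 j i
  have hβd : IsDominantChoice Q β := HasDominantColumnEntries.isDominantChoice hι hQ0 hs hQ
    fun i j => le_argmaxFin hs0 (Q i) j
  have hαd : IsDominantChoice P.transpose α :=
    HasDominantColumnEntries.isDominantChoice hι hP0' hr hP
      fun j i => le_argmaxFin hr0 (fun i => P i j) i
  refine .seq (.diag (by simp) hσ.one hσ.rows hrn s1 fun τ₁ hf₁ hB₁ => ?_)
  have hτ₁ := hσ.frame hf₁ (by simp) (by simp) (by simp) (by simp) (by simp) (by simp)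
  refine .seq (.diag (by simp) hτ₁.one hτ₁.cols hsn s1 fun τ₂ hf₂ hC₂ => ?_)
  have hτ₂ := hτ₁.frame hf₂ (by simp) (by simp) (by simp) (by simp) (by simp) (by simp)
  refine .seq (.walk (i := ⟨0, hr0⟩) hr0 hs0 hτ₂ hrn hsn
    (by rw [hf₂.idx 4 (by simp), hf₁.idx 4 (by simp), h4]) fun τ₃ hf₃ h4₃ => ?_)
  have hτ₃ := hτ₂.frame hf₃ (by simp) (by simp) (by simp) (by simp) (by simp) (by simp)
  -- After `r` steps the walk is on the cycle, which becomes the support `S` of the row player; its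
  -- image under `β` is that of the column player.
  obtain ⟨hinj, himg⟩ := injOn_orbitSegment_and_image_eq (fun i => α (β i)) ⟨0, hr0⟩
  set i₀ := (fun i => α (β i))^[r] ⟨0, hr0⟩ with hi₀
  set S := orbitSegment (fun i => α (β i)) i₀ r with hS
  have hne : S.Nonempty := ⟨i₀, Finset.mem_image.2 ⟨0, Finset.mem_range.2 hr0, rfl⟩⟩
  have hSβ : Set.InjOn β S := fun x hx y hy hxy => hinj hx hy (congrArg α hxy)
  have himg' : (S.image β).image α = S := by rw [Finset.image_image]; exact himg
  have hTα : Set.InjOn α (S.image β) := by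
    intro x hx y hy hxy
    obtain ⟨x', hx', rfl⟩ := Finset.mem_image.1 (Finset.mem_coe.1 hx)
    obtain ⟨y', hy', rfl⟩ := Finset.mem_image.1 (Finset.mem_coe.1 hy)
    rw [hinj hx' hy' hxy]
  have hB₃ : τ₃.Solves Q β ∅ 4 2 := by
    refine .empty (fun i j => ?_) fun i => ?_
    · rw [hf₃.num 4 (by simp), hf₂.num 4 (by simp), hB₁, h0 4 (by omega)]
      simp [Fin.val_inj]
    · rw [hf₃.num 2 (by simp), hf₂.num 2 (by simp), hf₁.num 2 (by simp), h0 2 le_rfl]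
  have hC₃ : τ₃.Solves P.transpose α ∅ 5 3 := by
    refine .empty (fun i j => ?_) fun i => ?_
    · rw [hf₃.num 5 (by simp), hC₂, hf₁.num 5 (by simp), h0 5 (by omega)]
      simp [Fin.val_inj]
    · rw [hf₃.num 3 (by simp), hf₂.num 3 (by simp), hf₁.num 3 (by simp), h0 3 (by omega)]
  refine .seq (.solve Z hr hs hP0 hQ0 hα hβ hαd hβd sP sQ le_rfl hrn hsn hτ₃ (i := i₀) h4₃ hinj
    hB₃ hC₃ fun τ₄ hf₄ hB₄ hC₄ => ?_)
  have hτ₄ := hτ₃.frame hf₄ (by simp) (by simp) (by simp) (by simp) (by simp) (by simp)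
  have hdetβ := det_indiffMatrix_ne_zero hQ0 hs hβd hSβ
  have hdetα := det_indiffMatrix_ne_zero hP0' hr hαd hTα
  set x := (indiffMatrix Q β S)⁻¹.mulVec (indiffVec S 1) with hx
  set y := (indiffMatrix P.transpose α (S.image β))⁻¹.mulVec (indiffVec (S.image β) 1) with hy
  have hxs : (indiffMatrix Q β S).mulVec x = indiffVec S 1 := by
    rw [hx, Matrix.mulVec_mulVec, Matrix.mul_nonsing_inv _ (isUnit_iff_ne_zero.2 hdetβ),
      Matrix.one_mulVec]
  have hys : (indiffMatrix P.transpose α (S.image β)).mulVec y = indiffVec (S.image β) 1 := by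
    rw [hy, Matrix.mulVec_mulVec, Matrix.mul_nonsing_inv _ (isUnit_iff_ne_zero.2 hdetα),
      Matrix.one_mulVec]
  have hsx : ∑ l ∈ Finset.range r, τ₄.num 2 l 0 = ∑ i, x i := by
    rw [Finset.sum_range]
    exact Finset.sum_congr rfl fun i _ => hB₄.sol i
  have hsy : ∑ l ∈ Finset.range s, τ₄.num 3 l 0 = ∑ j, y j := by
    rw [Finset.sum_range]
    exact Finset.sum_congr rfl fun j _ => hC₄.sol j
  refine .seq (.normalize Z (N₀ := solutionBits n M) (by simp) (by simp) (by simp) (by simp)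
    hτ₄.zero hτ₄.one hτ₄.rows hrn (fun l hl => ?_) le_rfl ?_ fun τ₅ hf₅ hX₅ => ?_)
  · rw [show τ₄.num 2 l 0 = _ from hB₄.sol ⟨l, hl⟩]
    exact Z.mono (by unfold solutionBits; omega) (Z.indiffMatrix_solution sQ hrn β S hdetβ _)
  · rw [hsx]
    exact (indiffMatrix_solution_sum_pos hQ0 hs hβd hSβ hne hxs).ne'
  have hτ₅ := hτ₄.frame hf₅ (by simp) (by simp) (by simp) (by simp) (by simp) (by simp)
  have e3 : τ₅.num 3 = τ₄.num 3 := hf₅.num 3 (by simp)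
  refine .normalize Z (N₀ := solutionBits n M) (by simp) (by simp) (by simp) (by simp)
    hτ₅.zero hτ₅.one hτ₅.cols hsn (fun l hl => ?_) le_rfl ?_ fun τ₆ hf₆ hX₆ => ?_
  · rw [e3, show τ₄.num 3 l 0 = _ from hC₄.sol ⟨l, hl⟩]
    exact Z.mono (by unfold solutionBits; omega)
      (Z.indiffMatrix_solution (fun i j => sP j i) hsn α (S.image β) hdetα _)
  · rw [e3, hsy]
    exact (indiffMatrix_solution_sum_pos hP0' hr hαd hTα (hne.image β) hys).ne'
  convert isNashEquilibrium_of_indiffMatrix ι hι hr hs hP0 hQ0 hαd hβd hSβ hTα hne rfl himg' hxs hys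
    using 3 with i j
  · rw [outputVec, hf₆.num 2 (by simp), hX₅ i i.isLt, hsx, hB₄.sol]
  · rw [outputVec, hX₆ j j.isLt, e3, hsy, hC₄.sol]

theorem findsNashWithin_nashProg (Z : SizeScale K sz) (hι : StrictMono ι) {M n : ℕ} (hr : 1 ≤ r)
    (hs : 1 ≤ s) (hP0 : ∀ i j, 0 ≤ P i j) (hQ0 : ∀ i j, 0 ≤ Q i j)
    (hP : HasDominantColumnEntries (P.map ι)) (hQ : HasDominantColumnEntries (Q.map ι).transpose)
    (sP : ∀ i j, Z.Small M (P i j)) (sQ : ∀ i j, Z.Small M (Q i j)) (hn : r + s ≤ n) :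
    FindsNashWithin ι sz nashProg P Q (nashTime n M) := by
  -- The budget must already contain the input.
  have hM : M ≤ nashBits n M := by
    unfold nashBits updateBits solutionBits
    omega
  have h0 : (Z.budget (nashBits n M) n).Holds (inputStore P Q) := by
    refine ⟨fun a => ?_, fun A i j => ?_⟩
    · simp only [inputStore]
      change _ ≤ n
      split_ifs <;> omega
    · simp only [inputStore]
      split_ifs
      · exact Z.mono hM (sP _ _)
      · exact Z.mono hM (sQ _ _)
      · exact Z.mono (Nat.zero_le _) Z.zero
      · exact Z.mono (Nat.zero_le _) Z.zero
  set σ : Store K := (inputStore P Q).putIdx 3 1 with hσ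
  have hready : σ.Ready P Q := ⟨rfl, rfl, rfl, rfl, fun i j => by simp [hσ, inputStore],
    fun i j => by simp [hσ, inputStore]⟩
  have hzero : ∀ A, 2 ≤ A → ∀ i j, σ.num A i j = 0 := fun A hA i j => by
    have h1 : A ≠ 0 := by omega
    have h2 : A ≠ 1 := by omega
    simp [hσ, inputStore, h1, h2]
  have hpure : r = 1 ∨ s = 1 → (Z.budget (nashBits n M) n).Runs pureProg (pureSteps n)
      (fun τ => IsNashEquilibrium (P.map ι) (Q.map ι)
        (fun i => ι (outputVec 2 r τ i)) (fun j => ι (outputVec 3 s τ j))) σ := fun h =>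
    .pure hι hr hs h hready (show r ≤ n by omega) (show s ≤ n by omega) rfl
      (Z.mono (Nat.zero_le _) Z.one) (hzero 2 le_rfl) (hzero 3 (by omega))
  have hrun : (Z.budget (nashBits n M) n).Runs nashProg (nashSteps n)
      (fun τ => IsNashEquilibrium (P.map ι) (Q.map ι)
        (fun i => ι (outputVec 2 r τ i)) (fun j => ι (outputVec 3 s τ j))) (inputStore P Q) := by
    refine .seq (.setIdx (show 1 ≤ n by omega) (.cond (fun h => ?_) fun h => .cond (fun h' => ?_)
      fun h' => ?_))
    · exact (hpure (.inl h)).mono (by omega) fun _ h => h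
    · exact (hpure (.inr h')).mono (by omega) fun _ h => h
    · have h1 : r ≠ 1 := h
      have h2 : s ≠ 1 := h'
      exact (Budget.Runs.mixed Z hι (by omega) (by omega) hP0 hQ0 hP hQ sP sQ (by omega) (by omega)
        hready rfl hzero).mono (by omega) fun _ h => h
  obtain ⟨τ, t, g1, g2, -, g4⟩ := hrun h0
  exact ⟨τ, t, g1, g2, g4⟩

end Program

/-! ### Polynomial bounds -/

/-- The function is given by a polynomial with natural coefficients. -/
def IsPolyFun (f : ℕ → ℕ) : Prop := ∃ p : Polynomial ℕ, ∀ n, p.eval n = f n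

theorem IsPolyFun.const (c : ℕ) : IsPolyFun fun _ => c := ⟨Polynomial.C c, by simp⟩

theorem IsPolyFun.id : IsPolyFun fun n => n := ⟨Polynomial.X, by simp⟩

theorem IsPolyFun.add {f g : ℕ → ℕ} (hf : IsPolyFun f) (hg : IsPolyFun g) :
    IsPolyFun fun n => f n + g n := by
  obtain ⟨p, hp⟩ := hf
  obtain ⟨q, hq⟩ := hg
  exact ⟨p + q, by simp [hp, hq]⟩

theorem IsPolyFun.mul {f g : ℕ → ℕ} (hf : IsPolyFun f) (hg : IsPolyFun g) :
    IsPolyFun fun n => f n * g n := by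
  obtain ⟨p, hp⟩ := hf
  obtain ⟨q, hq⟩ := hg
  exact ⟨p * q, by simp [hp, hq]⟩

theorem IsPolyFun.nashTime {f g : ℕ → ℕ} (hf : IsPolyFun f) (hg : IsPolyFun g) :
    IsPolyFun fun n => nashTime (f n) (g n) := by
  unfold FieldRAM.nashTime nashBits nashSteps pureSteps mixedSteps normalizeSteps solveSteps
    walkSteps updateBits solutionBits invBits updateSteps diagSteps axpySteps scaleSteps dotSteps
    argmaxSteps loopSteps
  -- Squares become products, so closure under sums and products is enough.
  simp only [sq]
  repeat' first
    | with_reducible exact hf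
    | with_reducible exact hg
    | with_reducible exact IsPolyFun.const _
    | with_reducible apply IsPolyFun.add
    | with_reducible apply IsPolyFun.mul

theorem bitSize_le_inputBitSize {r s : ℕ} (P Q : Matrix (Fin r) (Fin s) ℚ) (i : Fin r)
    (j : Fin s) : bitSize (P i j) + bitSize (Q i j) ≤ inputBitSize P Q :=
  (Finset.single_le_sum (f := fun j => bitSize (P i j) + bitSize (Q i j))
    (fun _ _ => Nat.zero_le _) (Finset.mem_univ j)).trans
    (Finset.single_le_sum (f := fun i => ∑ j, (bitSize (P i j) + bitSize (Q i j)))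
      (fun _ _ => Nat.zero_le _) (Finset.mem_univ i))

/-- Each of the `r * s` positions contributes at least one bit, and `r + s ≤ r * s + 1` because `(r
- 1) * (s - 1) ≥ 0`. So the bit length also bounds the dimensions. -/
theorem add_le_inputBitSize {r s : ℕ} (hr : 1 ≤ r) (hs : 1 ≤ s)
    (P Q : Matrix (Fin r) (Fin s) ℚ) : r + s ≤ inputBitSize P Q + 1 := by
  have h1 : ∑ _i : Fin r, ∑ _j : Fin s, 1 ≤ inputBitSize P Q :=
    Finset.sum_le_sum fun i _ => Finset.sum_le_sum fun j _ => by unfold bitSize; omega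
  simp only [Finset.sum_const, Finset.card_univ, Fintype.card_fin, smul_eq_mul, mul_one] at h1
  nlinarith

end FieldRAM

theorem proposition5 :
    ∃ (c : FieldRAM.Prog) (p q : Polynomial ℕ),
      (∀ (r s : ℕ) (P Q : Matrix (Fin r) (Fin s) ℝ), 1 ≤ r → 1 ≤ s →
        (∀ i j, 0 ≤ P i j) → (∀ i j, 0 ≤ Q i j) →
        HasDominantColumnEntries P → HasDominantColumnEntries Q.transpose →
        FieldRAM.FindsNashWithin (fun a : ℝ => a) FieldRAM.unitSize c P Q (p.eval (r + s))) ∧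
      (∀ (r s : ℕ) (P Q : Matrix (Fin r) (Fin s) ℚ), 1 ≤ r → 1 ≤ s →
        (∀ i j, 0 ≤ P i j) → (∀ i j, 0 ≤ Q i j) →
        HasDominantColumnEntries (P.map (fun a : ℚ => (a : ℝ))) →
        HasDominantColumnEntries (Q.map (fun a : ℚ => (a : ℝ))).transpose →
        FieldRAM.FindsNashWithin (fun a : ℚ => (a : ℝ)) FieldRAM.bitSize c P Q
          (q.eval (FieldRAM.inputBitSize P Q))) := by
  -- Real numbers have size zero, so only the dimension `r + s` matters.
  obtain ⟨p, hp⟩ := FieldRAM.IsPolyFun.nashTime .id (.const 0)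
  -- With input length `L`, indices are at most `L + 1` and payoffs have at most `L` bits.
  obtain ⟨q, hq⟩ := FieldRAM.IsPolyFun.nashTime (.add .id (.const 1)) .id
  refine ⟨FieldRAM.nashProg, p, q, fun r s P Q hr hs hP0 hQ0 hP hQ => ?_,
    fun r s P Q hr hs hP0 hQ0 hP hQ => ?_⟩
  · rw [hp]
    exact FieldRAM.findsNashWithin_nashProg (ι := RingHom.id ℝ) FieldRAM.realScale strictMono_id
      hr hs hP0 hQ0 hP hQ (fun _ _ => trivial) (fun _ _ => trivial) le_rfl
  · rw [hq]
    refine FieldRAM.findsNashWithin_nashProg (ι := Rat.castHom ℝ) FieldRAM.ratScale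
      (fun _ _ h => Rat.cast_lt.2 h) hr hs hP0 hQ0 hP hQ (fun i j => ?_) (fun i j => ?_)
      (FieldRAM.add_le_inputBitSize hr hs P Q)
    · exact (FieldRAM.fracBound_bitSize _).mono
        (le_of_add_le_left (FieldRAM.bitSize_le_inputBitSize P Q i j))
    · exact (FieldRAM.fracBound_bitSize _).mono
        (le_of_add_le_right (FieldRAM.bitSize_le_inputBitSize P Q i j))
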